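/- **Setting.** Let $m_1,m_2\ge 1$, $m=\min(m_1,m_2)$, $d=m_1+m_2$, $A_0\in\mathbb R^{m_1\times m_2}$, and let $\Pi=(\pi_{kl})$ be a probability distribution on the positions $(k,l)$. One observes $(T_i,Y_i)$, $i=1,\dots,n$, with $Y_i=\langle T_i,A_0\rangle+\sigma\xi_i$, $\sigma>0$, where the $T_i$ are i.i.d. random matrices having a single nonzero entry, equal to $1$, at position $(k,l)$ with probability $\pi_{kl}$; the $\xi_i$ satisfy $\mathbb E\xi_i=0$, $\mathbb E\xi_i^2=1$; the pairs $(T_i,\xi_i)$ are independent over $i$, and $T_i$ is independent of $\xi_i$. For $a>0$ put $\mathrm{TL1}_a(A)=\sum_{j=1}^{m}\frac{(a+1)\sigma_j(A)}{a+\sigma_j(A)}$ with $\sigma_j(A)$ the singular values of $A$, and let $\hat A$ be any minimizer of $$\frac1n\sum_{i=1}^n (Y_i-\langle T_i,A\rangle)^2+\lambda\,\mathrm{TL1}_a(A)\quad\text{over } \|A\|_\infty:=\max_{k,l}|A(k,l)|\le\zeta .$$ **Assumptions.** (1) $\sum_l\pi_{kl}\le L/m$ for all $k$ and $\sum_k\pi_{kl}\le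 L/m$ for all $l$, with $L\ge1$; (2) $\frac1{\nu m_1m_2}\le\pi_{kl}\le\frac{\nu}{m_1m_2}$ for all $k,l$, with $\nu\ge 1$; (3) $\max_i\mathbb E\exp(|\xi_i|/c_0)\le e$, with $c_0>0$; (4) $\|A_0\|_\infty\le\zeta$ and $\|A_0\|_*/\sqrt{m_1m_2}\le\gamma$, with $\gamma>0$ and $\|\cdot\|_*$ the nuclear norm. **Theorem 1.** There is $\kappa=\kappa(L)>0$, depending only on $L$, such that for all $c_0,b>0$ there are $s,C_2>0$, depending only on $c_0,b$, such that for all $S\ge s$ and $q>0$ there is $C_1>0$, depending only on $c_0,b,S,q$, with the following property. Under the assumptions above, if $n\ge b\,d\log d$, $\ \zeta\sqrt{m_1m_2}\le q\,a$, and $$ s\,\Lambda\le\lambda\le S\,\Lambda,\qquad \Lambda=\frac{\zeta\vee\sigma}{\sqrt{m_1m_2}}\cdot\frac{a+\zeta\sqrt{m_1m_2}}{1+a}\sqrt{\frac{Ld\log d}{n}},$$ then, with probability at least $1-(\kappa+1)/d$, every minimizer $\hat A$ satisfies $$\frac{1}{m_1m_2}\|\hat A-A_0\|_F^2\le C_1\,\nu\,(\zeta\vee\sigma)\,\gamma\sqrt{\frac{Ld\log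 d}{n}}+C_2\,\nu\,\zeta^2\sqrt{\frac{L\log d}{n}} .$$ -/

import Mathlib

open MeasureTheory ProbabilityTheory

noncomputable section

namespace TL1Completion

/-- The product (equivalently Borel) sigma-algebra on the space of real matrices. -/
instance matrixMeasurableSpace {m₁ m₂ : ℕ} : MeasurableSpace (Matrix (Fin m₁) (Fin m₂) ℝ) :=
  inferInstanceAs (MeasurableSpace (Fin m₁ → Fin m₂ → ℝ))

/-- The `j`-th singular value (in decreasing order, counted from `j = 0`) of a real matrix,
acting between Euclidean spaces. -/
def singVal {m₁ m₂ : ℕ} (A : Matrix (Fin m₁) (Fin m₂) ℝ) (j : ℕ) : ℝ :=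
  (Matrix.toEuclideanLin A).singularValues j

/-- The nuclear norm, the sum of the `min m₁ m₂` singular values. -/
def nuclearNorm {m₁ m₂ : ℕ} (A : Matrix (Fin m₁) (Fin m₂) ℝ) : ℝ :=
  ∑ j ∈ Finset.range (min m₁ m₂), singVal A j

/-- The Frobenius norm. -/
def frobeniusNorm {m₁ m₂ : ℕ} (A : Matrix (Fin m₁) (Fin m₂) ℝ) : ℝ :=
  Real.sqrt (∑ k, ∑ l, A k l ^ 2)

/-- The trace inner product `tr (Tᵀ A)`. -/
def traceInner {m₁ m₂ : ℕ} (T A : Matrix (Fin m₁) (Fin m₂) ℝ) : ℝ :=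
  (T.transpose * A).trace

/-- The transformed `ℓ₁` penalty on the singular values, with internal parameter `a`. -/
def TL1 {m₁ m₂ : ℕ} (a : ℝ) (A : Matrix (Fin m₁) (Fin m₂) ℝ) : ℝ :=
  ∑ j ∈ Finset.range (min m₁ m₂), (a + 1) * singVal A j / (a + singVal A j)

/-- The set of matrices all of whose entries are bounded by `ζ` in absolute value. -/
def entryBall (m₁ m₂ : ℕ) (ζ : ℝ) : Set (Matrix (Fin m₁) (Fin m₂) ℝ) :=
  {A | ∀ k l, |A k l| ≤ ζ}

/-- The TL1-penalised least-squares objective, for indicator matrices `T i` and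
observations `Y i`. -/
def objective {m₁ m₂ n : ℕ} (T : Fin n → Matrix (Fin m₁) (Fin m₂) ℝ) (Y : Fin n → ℝ)
    (lam a : ℝ) (A : Matrix (Fin m₁) (Fin m₂) ℝ) : ℝ :=
  (1 / (n : ℝ)) * ∑ i, (Y i - traceInner (T i) A) ^ 2 + lam * TL1 a A

/-- `Ahat` is a minimiser of the objective over the matrices with entries bounded by `ζ`. -/
def IsTL1Estimator {m₁ m₂ n : ℕ} (T : Fin n → Matrix (Fin m₁) (Fin m₂) ℝ) (Y : Fin n → ℝ)
    (lam a ζ : ℝ) (Ahat : Matrix (Fin m₁) (Fin m₂) ℝ) : Prop :=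
  Ahat ∈ entryBall m₁ m₂ ζ ∧ IsMinOn (objective T Y lam a) (entryBall m₁ m₂ ζ) Ahat

/-- The observations of the trace regression model with noise level `σ`. -/
def observation {m₁ m₂ n : ℕ} (A₀ : Matrix (Fin m₁) (Fin m₂) ℝ) (σ : ℝ)
    (T : Fin n → Matrix (Fin m₁) (Fin m₂) ℝ) (ξ : Fin n → ℝ) (i : Fin n) : ℝ :=
  traceInner (T i) A₀ + σ * ξ i

/-- The random matrix `T` takes values (almost surely) in the set of matrices with a single
nonzero entry, equal to `1`, and this entry is at `(k, l)` with probability `p k l`. -/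
structure HasIndicatorLaw {m₁ m₂ : ℕ} {Ω : Type*} [MeasurableSpace Ω] (μ : Measure Ω)
    (p : Fin m₁ → Fin m₂ → ℝ) (T : Ω → Matrix (Fin m₁) (Fin m₂) ℝ) : Prop where
  measurable : Measurable T
  mem_indicators : ∀ᵐ ω ∂μ, ∃ k l, T ω = Matrix.single k l 1
  prob_eq : ∀ k l, μ.real {ω | T ω = Matrix.single k l 1} = p k l

/-- Sampling and noise: the indicator matrices `T i` all have law `p`, the noise variables
`ξ i` are centred with unit variance, the pairs `(T i, ξ i)` are independent over `i`, and `T i`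
is independent of `ξ i`. -/
structure IsTraceRegression {m₁ m₂ n : ℕ} {Ω : Type*} [MeasurableSpace Ω] (μ : Measure Ω)
    (p : Fin m₁ → Fin m₂ → ℝ) (T : Fin n → Ω → Matrix (Fin m₁) (Fin m₂) ℝ)
    (ξ : Fin n → Ω → ℝ) : Prop where
  law : ∀ i, HasIndicatorLaw μ p (T i)
  noise_measurable : ∀ i, Measurable (ξ i)
  noise_mean : ∀ i, Integrable (ξ i) μ ∧ ∫ ω, ξ i ω ∂μ = 0
  noise_variance : ∀ i, Integrable (fun ω => ξ i ω ^ 2) μ ∧ ∫ ω, ξ i ω ^ 2 ∂μ = 1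
  indep_pairs : iIndepFun (fun i ω => (T i ω, ξ i ω)) μ
  indep_noise : ∀ i, IndepFun (T i) (ξ i) μ

/-- Row and column marginals of the sampling distribution are at most `L / min m₁ m₂`. -/
def MarginalBound {m₁ m₂ : ℕ} (p : Fin m₁ → Fin m₂ → ℝ) (L : ℝ) : Prop :=
  (∀ k, ∑ l, p k l ≤ L / (min m₁ m₂ : ℕ)) ∧ ∀ l, ∑ k, p k l ≤ L / (min m₁ m₂ : ℕ)

/-- Every entry is sampled with probability within the factor `ν` of the uniform one. -/
def NearUniform {m₁ m₂ : ℕ} (p : Fin m₁ → Fin m₂ → ℝ) (ν : ℝ) : Prop :=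
  ∀ k l, 1 / (ν * m₁ * m₂) ≤ p k l ∧ p k l ≤ ν / (m₁ * m₂)

/-- The noise variables are sub-exponential with constant `c₀`: `E exp (|ξ i| / c₀) ≤ e`. -/
def SubExponentialNoise {n : ℕ} {Ω : Type*} [MeasurableSpace Ω] (μ : Measure Ω)
    (ξ : Fin n → Ω → ℝ) (c₀ : ℝ) : Prop :=
  ∀ i, Integrable (fun ω => Real.exp (|ξ i ω| / c₀)) μ ∧
    ∫ ω, Real.exp (|ξ i ω| / c₀) ∂μ ≤ Real.exp 1

/-- `d = m₁ + m₂` as a real number. -/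
def dimSum (m₁ m₂ : ℕ) : ℝ := (m₁ : ℝ) + m₂

/-- The rate `√(L d log d / n)`. -/
def mainRate (m₁ m₂ n : ℕ) (L : ℝ) : ℝ :=
  Real.sqrt (L * dimSum m₁ m₂ * Real.log (dimSum m₁ m₂) / n)

/-- The order of magnitude of the regularisation parameter. -/
def lambdaOrder (m₁ m₂ n : ℕ) (L ζ σ a : ℝ) : ℝ :=
  max ζ σ / Real.sqrt (m₁ * m₂) * ((a + ζ * Real.sqrt (m₁ * m₂)) / (1 + a)) * mainRate m₁ m₂ n L

end TL1Completion

end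

/-! On matrices with entries at most ζ, all singular values are at most R = ζ√(m₁m₂). There the TL1
penalty lies between (a+1)/(a+R) and (a+1)/a times the nuclear norm (`le_TL1`, `TL1_le`), so the
nonconvex penalty can be handled like a nuclear norm penalty.

Comparing the objective at Â and at A₀ (`IsTL1Estimator.basic_inequality`) bounds the empirical
quadratic form of Â - A₀. The noise term is bounded by trace duality: the operator norm of ∑ ξᵢ Tᵢ
times ‖Â‖_* + ‖A₀‖_*. To pass to the population form, `prodMean_violation_le` bounds its excess over
the empirical one uniformly over the entry ball, again up to a multiple of ‖Â‖_* + ‖A₀‖_*. It uses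
symmetrisation and contraction, which leave the operator norm of ∑ εᵢ Tᵢ with random signs. The
constant s is chosen so that λ TL1(Â) absorbs every term in ‖Â‖_*
(`IsTL1Estimator.quadratic_form_le`). What remains is a multiple of ‖A₀‖_*, which gives the first
term of the rate, and the slack of the uniform bound, which gives the second.

Both operator norms are handled by one moment method. An even power of the norm is at most the trace
of that power of the symmetric dilation. The trace expands over words in the sample indices, and the
expectation of each word factorises into moments of the marks and a mean over positions. A word with
j distinct letters has position mean at most dρʲ with ρ = L/min(m₁,m₂) (`prodMean_word_le`). Centred
marks kill the words in which some letter occurs exactly once. An exponential generating function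
sums the rest, and an order comparable to log d gives the bound (`sum_word_gaussian_moments_le`).

Since there are finitely many positions, means over them are finite weighted sums (`prodMean`), and
the suprema involved run over finite index sets. -/

namespace TL1Completion

open scoped Matrix.Norms.L2Operator

/-! ### Singular values, trace duality, the TL1 sandwich and the symmetric dilation. -/

section LinearAlgebra

variable {m₁ m₂ : ℕ}

lemma traceInner_eq_sum (M A : Matrix (Fin m₁) (Fin m₂) ℝ) :
    traceInner M A = ∑ k, ∑ l, M k l * A k l := by
  simp only [traceInner, Matrix.trace, Matrix.diag, Matrix.mul_apply, Matrix.transpose_apply]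
  exact Finset.sum_comm

lemma traceInner_single (k : Fin m₁) (l : Fin m₂) (A : Matrix (Fin m₁) (Fin m₂) ℝ) :
    traceInner (Matrix.single k l 1) A = A k l := by
  rw [traceInner_eq_sum, Finset.sum_eq_single k, Finset.sum_eq_single l]
  · simp
  · intro b _ hb; simp [hb.symm]
  · simp
  · intro b _ hb; simp [hb.symm]
  · simp

lemma singVal_nonneg (A : Matrix (Fin m₁) (Fin m₂) ℝ) (j : ℕ) : 0 ≤ singVal A j :=
  LinearMap.singularValues_nonneg _ _

lemma nuclearNorm_nonneg (A : Matrix (Fin m₁) (Fin m₂) ℝ) : 0 ≤ nuclearNorm A :=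
  Finset.sum_nonneg fun _ _ => singVal_nonneg _ _

/-- The nuclear norm may be computed with all `m₂` singular values, as the extra ones vanish. -/
lemma nuclearNorm_eq_sum_fin (A : Matrix (Fin m₁) (Fin m₂) ℝ) :
    nuclearNorm A = ∑ j : Fin m₂, singVal A j := by
  rw [nuclearNorm, Fin.sum_univ_eq_sum_range (fun j => singVal A j)]
  refine Finset.sum_subset (by intro j; simp) ?_
  intro j hj hj'
  rw [singVal, LinearMap.singularValues_eq_zero_iff_le_finrank_range]
  simp only [Finset.mem_range, lt_min_iff, not_and_or, not_lt] at hj hj'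
  have h := Submodule.finrank_le (LinearMap.range (Matrix.toEuclideanLin A))
  rw [finrank_euclideanSpace_fin] at h
  omega

/-- An orthonormal basis of right singular vectors. -/
lemma exists_orthonormalBasis_norm_eq_singVal (A : Matrix (Fin m₁) (Fin m₂) ℝ) :
    ∃ v : OrthonormalBasis (Fin m₂) ℝ (EuclideanSpace ℝ (Fin m₂)),
      ∀ j, ‖Matrix.toEuclideanLin A (v j)‖ = singVal A j := by
  set T := Matrix.toEuclideanLin A
  have hn : Module.finrank ℝ (EuclideanSpace ℝ (Fin m₂)) = m₂ := finrank_euclideanSpace_fin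
  refine ⟨T.isSymmetric_adjoint_comp_self.eigenvectorBasis hn, fun j => ?_⟩
  refine (sq_eq_sq₀ (norm_nonneg _) (singVal_nonneg _ _)).1 ?_
  rw [singVal, T.sq_singularValues_fin hn, ← real_inner_self_eq_norm_sq,
    ← LinearMap.adjoint_inner_left, ← LinearMap.comp_apply,
    LinearMap.IsSymmetric.apply_eigenvectorBasis, real_inner_smul_left]
  simp

lemma norm_toEuclideanLin_le (M : Matrix (Fin m₁) (Fin m₂) ℝ) (x : EuclideanSpace ℝ (Fin m₂)) :
    ‖Matrix.toEuclideanLin M x‖ ≤ ‖M‖ * ‖x‖ :=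
  M.l2_opNorm_mulVec x

/-- Trace duality between the operator norm and the nuclear norm. -/
lemma abs_traceInner_le (M A : Matrix (Fin m₁) (Fin m₂) ℝ) :
    |traceInner M A| ≤ ‖M‖ * nuclearNorm A := by
  obtain ⟨v, hv⟩ := exists_orthonormalBasis_norm_eq_singVal A
  -- The trace of MᵀA is evaluated in a basis of right singular vectors of A. Cauchy–Schwarz then
  -- gives at most ‖M‖ times one singular value for each basis vector.
  have key : traceInner M A =
      ∑ j, inner ℝ (Matrix.toEuclideanLin M (v j)) (Matrix.toEuclideanLin A (v j)) := by
    have h1 : traceInner M A = LinearMap.trace ℝ _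
        (LinearMap.adjoint (Matrix.toEuclideanLin M) ∘ₗ Matrix.toEuclideanLin A) := by
      rw [LinearMap.trace_eq_sum_inner _ (EuclideanSpace.basisFun (Fin m₂) ℝ), traceInner_eq_sum,
        Finset.sum_comm]
      refine Finset.sum_congr rfl fun l _ => ?_
      rw [LinearMap.comp_apply, LinearMap.adjoint_inner_right]
      simp [Matrix.toLpLin_apply, PiLp.inner_apply, mul_comm]
    rw [h1, LinearMap.trace_eq_sum_inner _ v]
    refine Finset.sum_congr rfl fun l _ => ?_
    rw [LinearMap.comp_apply, LinearMap.adjoint_inner_right]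
  rw [key, nuclearNorm_eq_sum_fin, Finset.mul_sum]
  refine (Finset.abs_sum_le_sum_abs _ _).trans (Finset.sum_le_sum fun j _ => ?_)
  refine (abs_real_inner_le_norm _ _).trans ?_
  rw [hv]
  refine mul_le_mul_of_nonneg_right ?_ (singVal_nonneg _ _)
  simpa using norm_toEuclideanLin_le M (v j)

lemma frobeniusNorm_nonneg (A : Matrix (Fin m₁) (Fin m₂) ℝ) : 0 ≤ frobeniusNorm A :=
  Real.sqrt_nonneg _

lemma frobeniusNorm_sq (A : Matrix (Fin m₁) (Fin m₂) ℝ) :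
    frobeniusNorm A ^ 2 = ∑ k, ∑ l, A k l ^ 2 :=
  Real.sq_sqrt (Finset.sum_nonneg fun _ _ => Finset.sum_nonneg fun _ _ => sq_nonneg _)

lemma sq_norm_toEuclideanLin_le {ι κ : Type*} [Fintype ι] [Fintype κ] [DecidableEq κ]
    (M : Matrix ι κ ℝ) (x : EuclideanSpace ℝ κ) :
    ‖Matrix.toEuclideanLin M x‖ ^ 2 ≤ (∑ k, ∑ l, M k l ^ 2) * ‖x‖ ^ 2 := by
  rw [EuclideanSpace.norm_sq_eq, EuclideanSpace.norm_sq_eq, Finset.sum_mul]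
  refine Finset.sum_le_sum fun k _ => ?_
  simp only [Matrix.toLpLin_apply, Real.norm_eq_abs, sq_abs, Matrix.mulVec, dotProduct]
  exact Finset.sum_mul_sq_le_sq_mul_sq _ _ _

lemma singVal_le_frobeniusNorm (A : Matrix (Fin m₁) (Fin m₂) ℝ) (j : ℕ) :
    singVal A j ≤ frobeniusNorm A := by
  by_cases hj : j < m₂
  · obtain ⟨v, hv⟩ := exists_orthonormalBasis_norm_eq_singVal A
    rw [← hv ⟨j, hj⟩]
    refine le_of_sq_le_sq ?_ (frobeniusNorm_nonneg A)
    rw [frobeniusNorm_sq]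
    simpa using sq_norm_toEuclideanLin_le A (v ⟨j, hj⟩)
  · rw [singVal, LinearMap.singularValues_of_finrank_le]
    · exact frobeniusNorm_nonneg A
    · rw [finrank_euclideanSpace_fin]; omega

lemma frobeniusNorm_le_of_mem_entryBall {A : Matrix (Fin m₁) (Fin m₂) ℝ} {ζ : ℝ}
    (hζ : 0 ≤ ζ) (hA : A ∈ entryBall m₁ m₂ ζ) : frobeniusNorm A ≤ ζ * Real.sqrt (m₁ * m₂) := by
  refine Real.sqrt_le_iff.2 ⟨by positivity, ?_⟩
  rw [mul_pow, Real.sq_sqrt (by positivity)]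
  calc ∑ k, ∑ l, A k l ^ 2 ≤ ∑ _k : Fin m₁, ∑ _l : Fin m₂, ζ ^ 2 :=
        Finset.sum_le_sum fun k _ => Finset.sum_le_sum fun l _ =>
          sq_le_sq' (abs_le.1 (hA k l)).1 (abs_le.1 (hA k l)).2
    _ = ζ ^ 2 * (m₁ * m₂) := by simp; ring

lemma nuclearNorm_le_of_mem_entryBall {A : Matrix (Fin m₁) (Fin m₂) ℝ} {ζ : ℝ}
    (hζ : 0 ≤ ζ) (hA : A ∈ entryBall m₁ m₂ ζ) :
    nuclearNorm A ≤ m₂ * (ζ * Real.sqrt (m₁ * m₂)) := by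
  rw [nuclearNorm_eq_sum_fin]
  calc ∑ j : Fin m₂, singVal A j ≤ ∑ _j : Fin m₂, ζ * Real.sqrt (m₁ * m₂) :=
        Finset.sum_le_sum fun j _ => (singVal_le_frobeniusNorm A j).trans
          (frobeniusNorm_le_of_mem_entryBall hζ hA)
    _ = _ := by simp

lemma TL1_le {a : ℝ} (ha : 0 < a) (A : Matrix (Fin m₁) (Fin m₂) ℝ) :
    TL1 a A ≤ (a + 1) / a * nuclearNorm A := by
  rw [TL1, nuclearNorm, Finset.mul_sum]
  refine Finset.sum_le_sum fun j _ => ?_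
  have := singVal_nonneg A j
  rw [div_mul_eq_mul_div]
  gcongr
  linarith

lemma TL1_nonneg {a : ℝ} (ha : 0 < a) (A : Matrix (Fin m₁) (Fin m₂) ℝ) : 0 ≤ TL1 a A :=
  Finset.sum_nonneg fun j _ => by have := singVal_nonneg A j; positivity

/-- Each singular value is at most the Frobenius norm, so the denominators in the penalty are at
most a + ζ√(m₁m₂). This is what lets the penalty at the estimator pay for its nuclear norm. -/
lemma le_TL1 {a ζ : ℝ} (ha : 0 < a) (hζ : 0 ≤ ζ) {A : Matrix (Fin m₁) (Fin m₂) ℝ}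
    (hA : A ∈ entryBall m₁ m₂ ζ) :
    (a + 1) / (a + ζ * Real.sqrt (m₁ * m₂)) * nuclearNorm A ≤ TL1 a A := by
  rw [TL1, nuclearNorm, Finset.mul_sum]
  refine Finset.sum_le_sum fun j _ => ?_
  have h0 := singVal_nonneg A j
  have := (singVal_le_frobeniusNorm A j).trans (frobeniusNorm_le_of_mem_entryBall hζ hA)
  rw [div_mul_eq_mul_div]
  gcongr

/-- The symmetric dilation of a rectangular matrix. -/
def dilation (M : Matrix (Fin m₁) (Fin m₂) ℝ) : Matrix (Fin m₁ ⊕ Fin m₂) (Fin m₁ ⊕ Fin m₂) ℝ :=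
  Matrix.fromBlocks 0 M M.transpose 0

lemma isSelfAdjoint_dilation (M : Matrix (Fin m₁) (Fin m₂) ℝ) : IsSelfAdjoint (dilation M) := by
  rw [IsSelfAdjoint, Matrix.star_eq_conjTranspose, Matrix.conjTranspose_eq_transpose_of_trivial,
    dilation, Matrix.fromBlocks_transpose]
  simp

/-- The dilation sends (0, x) to (Mx, 0), and both embeddings are isometric. -/
lemma norm_le_norm_dilation (M : Matrix (Fin m₁) (Fin m₂) ℝ) : ‖M‖ ≤ ‖dilation M‖ := by
  rw [Matrix.l2_opNorm_def]
  refine ContinuousLinearMap.opNorm_le_bound _ (norm_nonneg _) fun x => ?_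
  set y : EuclideanSpace ℝ (Fin m₁ ⊕ Fin m₂) := WithLp.toLp 2 (Sum.elim 0 x) with hy
  have h := (dilation M).l2_opNorm_mulVec y
  have h1 : ‖y‖ = ‖x‖ := by
    simp [EuclideanSpace.norm_eq, hy]
  have h2 : ‖(EuclideanSpace.equiv _ ℝ).symm ((dilation M).mulVec y)‖
      = ‖Matrix.toEuclideanLin M x‖ := by
    have h3 : M.transpose.mulVec (fun _ => 0) = 0 := M.transpose.mulVec_zero
    simp [EuclideanSpace.norm_eq, hy, dilation, Matrix.fromBlocks_mulVec,
      Matrix.toLpLin_apply, Function.comp_def, h3]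
  rw [h1, h2] at h
  exact h

lemma sq_norm_le_trace_sq {V : Type*} [Fintype V] [DecidableEq V] {D : Matrix V V ℝ}
    (hD : IsSelfAdjoint D) : ‖D‖ ^ 2 ≤ (D ^ 2).trace := by
  have h1 : (D ^ 2).trace = ∑ k, ∑ l, D k l ^ 2 := by
    have hs : ∀ k l, D l k = D k l := fun k l => by
      have := congrFun (congrFun hD l) k
      simpa [Matrix.star_apply] using this.symm
    simp only [sq, Matrix.trace, Matrix.diag, Matrix.mul_apply, hs]
  rw [h1]
  have h0 : 0 ≤ ∑ k, ∑ l, D k l ^ 2 :=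
    Finset.sum_nonneg fun _ _ => Finset.sum_nonneg fun _ _ => sq_nonneg _
  refine (Real.le_sqrt (norm_nonneg _) h0).1 ?_
  rw [Matrix.l2_opNorm_def]
  refine ContinuousLinearMap.opNorm_le_bound _ (Real.sqrt_nonneg _) fun x => ?_
  refine le_of_sq_le_sq ?_ (by positivity)
  rw [mul_pow, Real.sq_sqrt h0]
  exact sq_norm_toEuclideanLin_le D x

/-- The operator norm is controlled by traces of even powers of the dilation. -/
lemma norm_pow_le_trace_dilation_pow (M : Matrix (Fin m₁) (Fin m₂) ℝ) (r : ℕ) :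
    ‖M‖ ^ (2 * 2 ^ r) ≤ (dilation M ^ (2 * 2 ^ r)).trace := by
  -- Powers of two appear because iterating ‖D²‖ = ‖D‖² for self-adjoint D gives ‖D^(2^r)‖ =
  -- ‖D‖^(2^r).
  have h := sq_norm_le_trace_sq ((isSelfAdjoint_dilation M).pow (2 ^ r))
  rw [(isSelfAdjoint_dilation M).norm_pow_two_pow, ← pow_mul, ← pow_mul, mul_comm] at h
  exact (pow_le_pow_left₀ (norm_nonneg _) (norm_le_norm_dilation M) _).trans h

end LinearAlgebra

/-! ### Means over finite product weights, and mean row sums of matrix words. -/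

section ProductMean

variable {ι K : Type*} [Fintype ι] [DecidableEq ι] [Fintype K]

/-- The mean of `F` under the product over `ι` of the weights `w`. -/
noncomputable def prodMean (w : K → ℝ) (F : (ι → K) → ℝ) : ℝ := ∑ v, (∏ i, w (v i)) * F v

lemma prodMean_mono {w : K → ℝ} (hw : ∀ a, 0 ≤ w a) {F G : (ι → K) → ℝ} (h : ∀ v, F v ≤ G v) :
    prodMean w F ≤ prodMean w G :=
  Finset.sum_le_sum fun v _ => mul_le_mul_of_nonneg_left (h v) (Finset.prod_nonneg fun _ _ => hw _)

lemma prodMean_nonneg {w : K → ℝ} (hw : ∀ a, 0 ≤ w a) {F : (ι → K) → ℝ} (h : ∀ v, 0 ≤ F v) :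
    0 ≤ prodMean w F :=
  Finset.sum_nonneg fun v _ => mul_nonneg (Finset.prod_nonneg fun _ _ => hw _) (h v)

lemma prodMean_const_mul (w : K → ℝ) (c : ℝ) (F : (ι → K) → ℝ) :
    prodMean w (fun v => c * F v) = c * prodMean w F := by
  simp only [prodMean, Finset.mul_sum]
  exact Finset.sum_congr rfl fun v _ => by ring

lemma prodMean_add (w : K → ℝ) (F G : (ι → K) → ℝ) :
    prodMean w (fun v => F v + G v) = prodMean w F + prodMean w G := by
  simp only [prodMean, ← Finset.sum_add_distrib, mul_add]

lemma prodMean_sum {κ : Type*} (s : Finset κ) (w : K → ℝ) (F : κ → (ι → K) → ℝ) :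
    prodMean w (fun v => ∑ k ∈ s, F k v) = ∑ k ∈ s, prodMean w (F k) := by
  simp only [prodMean, Finset.mul_sum]
  exact Finset.sum_comm

lemma prodMean_const {w : K → ℝ} (hw : ∑ a, w a = 1) (c : ℝ) :
    prodMean (ι := ι) w (fun _ => c) = c := by
  have h := Finset.prod_univ_sum (fun _ : ι => (Finset.univ : Finset K)) (fun _ a => w a)
  simp only [hw, Finset.prod_const_one, Fintype.piFinset_univ] at h
  simp only [prodMean, ← Finset.sum_mul, ← h, one_mul]

/-- Resampling one coordinate does not change the mean. -/
lemma prodMean_resample {w : K → ℝ} (hw : ∑ a, w a = 1) (i : ι) (F : (ι → K) → ℝ) :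
    prodMean w (fun v => ∑ a, w a * F (Function.update v i a)) = prodMean w F := by
  -- Exchanging the i-th coordinate with the fresh sample is an involution that preserves the joint
  -- weight.
  let e : (ι → K) × K → (ι → K) × K := fun p => (Function.update p.1 i p.2, p.1 i)
  have he : Function.Involutive e := by
    rintro ⟨v, a⟩
    simp [e]
  have hwt : ∀ (v : ι → K) (a : K),
      (∏ j, w (Function.update v i a j)) * w (v i) = (∏ j, w (v j)) * w a := by
    intro v a
    rw [← Finset.mul_prod_erase Finset.univ (fun j => w (Function.update v i a j))
      (Finset.mem_univ i), ← Finset.mul_prod_erase Finset.univ (fun j => w (v j))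
      (Finset.mem_univ i), Function.update_self]
    have : ∏ j ∈ Finset.univ.erase i, w (Function.update v i a j)
        = ∏ j ∈ Finset.univ.erase i, w (v j) :=
      Finset.prod_congr rfl fun j hj => by
        rw [Function.update_of_ne (Finset.ne_of_mem_erase hj)]
    rw [this]; ring
  calc prodMean w (fun v => ∑ a, w a * F (Function.update v i a))
      = ∑ p : (ι → K) × K, (∏ j, w ((e p).1 j)) * w (e p).2 * F (e p).1 := by
        simp only [prodMean, Fintype.sum_prod_type, Finset.mul_sum]
        refine Finset.sum_congr rfl fun v _ => Finset.sum_congr rfl fun a _ => ?_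
        rw [← mul_assoc, ← hwt]
    _ = ∑ p : (ι → K) × K, (∏ j, w (p.1 j)) * w p.2 * F p.1 :=
        Equiv.sum_comp he.toPerm (fun p : (ι → K) × K => (∏ j, w (p.1 j)) * w p.2 * F p.1)
    _ = prodMean w F := by
        simp only [prodMean, Fintype.sum_prod_type, mul_assoc, ← Finset.mul_sum]
        refine Finset.sum_congr rfl fun v _ => ?_
        rw [← Finset.sum_mul, hw, one_mul]

variable {V : Type*} [Fintype V] [DecidableEq V]

lemma list_prod_matrix_nonneg (l : List (Matrix V V ℝ)) (h : ∀ A ∈ l, ∀ u w, 0 ≤ A u w) (u w : V) :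
    0 ≤ l.prod u w := by
  induction l generalizing u w with
  | nil => simp only [List.prod_nil, Matrix.one_apply]; split_ifs <;> norm_num
  | cons A l ih =>
    rw [List.prod_cons, Matrix.mul_apply]
    exact Finset.sum_nonneg fun x _ => mul_nonneg (h A (by simp) u x)
      (ih (fun B hB => h B (by simp [hB])) x w)

/-- Mean row sums of a word in random sub-stochastic matrices: each new letter costs a
factor `ρ`, repeated letters are free. -/
lemma prodMean_word_le {w : K → ℝ} (hw0 : ∀ a, 0 ≤ w a) (hw : ∑ a, w a = 1)
    {B : K → Matrix V V ℝ} (hB0 : ∀ a u x, 0 ≤ B a u x) (hB1 : ∀ a u, ∑ x, B a u x ≤ 1)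
    {ρ : ℝ} (hρ : ∀ u, ∑ a, w a * ∑ x, B a u x ≤ ρ) (l : List ι) (u : V) :
    prodMean w (fun v => ∑ x, (l.map fun i => B (v i)).prod u x) ≤ ρ ^ l.toFinset.card := by
  induction l using List.reverseRecOn with
  | nil => simp [prodMean_const hw, Matrix.one_apply]
  | append_singleton l i ih =>
    have hW : ∀ (v : ι → K) y, 0 ≤ (l.map fun i => B (v i)).prod u y := fun v y =>
      list_prod_matrix_nonneg _ (by
        intro A hA; obtain ⟨i, _, rfl⟩ := List.mem_map.1 hA; exact hB0 _) _ _
    have hexp : ∀ v : ι → K, ∑ x, ((l ++ [i]).map fun i => B (v i)).prod u x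
        = ∑ y, (l.map fun i => B (v i)).prod u y * ∑ x, B (v i) y x := by
      intro v
      simp only [List.map_append, List.prod_append, List.map_cons, List.map_nil,
        List.prod_singleton, Matrix.mul_apply, Finset.mul_sum]
      exact Finset.sum_comm
    simp only [hexp]
    -- The last letter contributes only its row sum. If it has occurred before, the bound 1 is used.
    -- If it is new, the rest of the word does not depend on its coordinate, which can be resampled
    -- at the price of one factor ρ.
    by_cases hi : i ∈ l
    · have hc : (l ++ [i]).toFinset = l.toFinset := by
        ext j; simp only [List.mem_toFinset, List.mem_append, List.mem_singleton]
        constructor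
        · rintro (h | rfl) <;> assumption
        · exact Or.inl
      rw [hc]
      refine le_trans (prodMean_mono hw0 fun v => Finset.sum_le_sum fun y _ => ?_) ih
      exact mul_le_of_le_one_right (hW v y) (hB1 _ _)
    · have hc : (l ++ [i]).toFinset.card = l.toFinset.card + 1 := by
        rw [List.toFinset_append, Finset.card_union_of_disjoint]
        · simp
        · simp [hi]
      have hρ0 : 0 ≤ ρ := le_trans (Finset.sum_nonneg fun a _ =>
        mul_nonneg (hw0 a) (Finset.sum_nonneg fun x _ => hB0 a u x)) (hρ u)
      rw [hc, ← prodMean_resample hw i, pow_succ, mul_comm]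
      refine le_trans ?_ (mul_le_mul_of_nonneg_left ih hρ0)
      rw [← prodMean_const_mul]
      refine prodMean_mono hw0 fun v => ?_
      have hup : ∀ a, (l.map fun j => B (Function.update v i a j)) = l.map fun j => B (v j) := by
        intro a
        refine List.map_congr_left fun j hj => ?_
        rw [Function.update_of_ne]
        rintro rfl; exact hi hj
      simp only [hup, Function.update_self, Finset.mul_sum]
      rw [Finset.sum_comm]
      refine Finset.sum_le_sum fun y _ => ?_
      have := mul_le_mul_of_nonneg_left (hρ y) (hW v y)
      rw [mul_comm ρ]
      refine le_trans (le_of_eq ?_) this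
      simp only [Finset.mul_sum]
      exact Finset.sum_congr rfl fun a _ => Finset.sum_congr rfl fun x _ => by ring

end ProductMean

/-! ### Sums over words, grouped by letter counts. -/

section WordSums

variable {ι : Type*} [Fintype ι]

lemma sum_pow_eq_sum_word {R : Type*} [Semiring R] (Y : ι → R) (k : ℕ) :
    (∑ i, Y i) ^ k = ∑ f : Fin k → ι, ((List.ofFn f).map Y).prod := by
  induction k with
  | zero => simp
  | succ k ih =>
    rw [pow_succ', ih, ← (Fin.consEquiv fun _ => ι).sum_comp, Fintype.sum_prod_type, Finset.sum_mul]
    refine Finset.sum_congr rfl fun i _ => ?_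
    rw [Finset.mul_sum]
    refine Finset.sum_congr rfl fun f _ => ?_
    simp [Fin.consEquiv, List.ofFn_succ]

variable [DecidableEq ι]

/-- The number of occurrences of the letter `i` in the word `f`. -/
def letterCount {k : ℕ} (f : Fin k → ι) (i : ι) : ℕ := (Finset.univ.filter fun j => f j = i).card

lemma prod_word_eq_prod_pow {R : Type*} [CommMonoid R] {k : ℕ} (f : Fin k → ι) (y : ι → R) :
    ∏ j, y (f j) = ∏ i, y i ^ letterCount f i := by
  rw [← Finset.prod_fiberwise Finset.univ f]
  refine Finset.prod_congr rfl fun i _ => ?_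
  rw [letterCount, Finset.prod_congr rfl (g := fun _ => y i), Finset.prod_const]
  intro j hj
  rw [(Finset.mem_filter.1 hj).2]

/-- Grouping words by their letter counts. -/
lemma sum_word_eq_sum_piAntidiag (F : (ι → ℕ) → ℝ) (k : ℕ) :
    ∑ f : Fin k → ι, F (letterCount f)
      = ∑ α ∈ Finset.univ.piAntidiag k, (Nat.multinomial Finset.univ α : ℝ) * F α := by
  -- The functional Λ sends the monomial X^α to F α. Applied to the multinomial expansion of (∑
  -- Xᵢ)^k, it gives the grouping identity without counting words by hand.
  let Λ : MvPolynomial ι ℝ →ₗ[ℝ] ℝ :=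
    (MvPolynomial.basisMonomials ι ℝ).constr ℝ (fun α : ι →₀ ℕ => F α)
  have hΛ : ∀ α : ι → ℕ, Λ (∏ i, MvPolynomial.X i ^ α i) = F α := by
    intro α
    have h1 : (∏ i, MvPolynomial.X i ^ α i : MvPolynomial ι ℝ)
        = MvPolynomial.basisMonomials ι ℝ (Finsupp.equivFunOnFinite.symm α) := by
      rw [MvPolynomial.coe_basisMonomials]
      beta_reduce
      rw [MvPolynomial.monomial_eq]
      simp [Finsupp.prod_fintype]
    rw [h1, Module.Basis.constr_basis]
    rfl
  have h := congrArg Λ (Finset.sum_pow_eq_sum_piAntidiag Finset.univ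
    (fun i : ι => (MvPolynomial.X i : MvPolynomial ι ℝ)) k)
  have h2 : ((∑ i : ι, (MvPolynomial.X i : MvPolynomial ι ℝ)) ^ k)
      = ∑ f : Fin k → ι, ∏ i, MvPolynomial.X i ^ letterCount f i := by
    rw [sum_pow_eq_sum_word]
    refine Finset.sum_congr rfl fun f _ => ?_
    rw [← prod_word_eq_prod_pow, List.map_ofFn, List.prod_ofFn]
    rfl
  rw [h2, map_sum, map_sum] at h
  simp only [hΛ] at h
  rw [h]
  refine Finset.sum_congr rfl fun α _ => ?_
  rw [← nsmul_eq_mul, map_nsmul, hΛ, nsmul_eq_mul]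

/-- Exponential generating function bound for a sum over words of a product of weights
depending on the letter counts. -/
lemma sum_word_prod_le {G : ℕ → ℝ} (hG : ∀ j, 0 ≤ G j) {θ : ℝ} (hθ : 0 < θ) (k : ℕ) :
    ∑ f : Fin k → ι, ∏ i, G (letterCount f i)
      ≤ (k.factorial : ℝ) / θ ^ k *
        (∑ j ∈ Finset.range (k + 1), G j * θ ^ j / j.factorial) ^ Fintype.card ι := by
  rw [sum_word_eq_sum_piAntidiag (fun α => ∏ i, G (α i))]
  have h1 : ∀ α ∈ (Finset.univ : Finset ι).piAntidiag k,
      (Nat.multinomial Finset.univ α : ℝ) * ∏ i, G (α i)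
        = (k.factorial : ℝ) / θ ^ k * ∏ i, (G (α i) * θ ^ α i / (α i).factorial) := by
    intro α hα
    have hs : ∑ i, α i = k := (Finset.mem_piAntidiag.1 hα).1
    have hm : (∏ i, ((α i).factorial : ℝ)) * Nat.multinomial Finset.univ α = k.factorial := by
      have := Nat.multinomial_spec Finset.univ α
      rw [hs] at this
      exact_mod_cast this
    have hpos : (0 : ℝ) < ∏ i, ((α i).factorial : ℝ) :=
      Finset.prod_pos fun i _ => by exact_mod_cast (α i).factorial_pos
    rw [Finset.prod_div_distrib, Finset.prod_mul_distrib, Finset.prod_pow_eq_pow_sum, hs, ← hm]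
    field_simp
  rw [Finset.sum_congr rfl h1, ← Finset.mul_sum]
  refine mul_le_mul_of_nonneg_left ?_ (by positivity)
  have h2 := Finset.prod_univ_sum (fun _ : ι => Finset.range (k + 1))
    (fun _ j => G j * θ ^ j / j.factorial)
  rw [Finset.prod_const, Finset.card_univ] at h2
  rw [h2]
  -- Dropping the constraint that the counts add up to k, and keeping only that each is at most k,
  -- makes the sum factorise over the letters.
  refine Finset.sum_le_sum_of_subset_of_nonneg ?_ ?_
  · intro α hα
    rw [Fintype.mem_piFinset]
    intro i
    have hs : ∑ i, α i = k := (Finset.mem_piAntidiag.1 hα).1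
    have := Finset.single_le_sum (f := α) (fun _ _ => Nat.zero_le _) (Finset.mem_univ i)
    rw [Finset.mem_range]; omega
  · intro α _ _
    exact Finset.prod_nonneg fun i _ => by have := hG (α i); positivity

end WordSums

/-! ### Trace moments of sums of independent marked matrices. -/

section TraceMoments

variable {ι K V : Type*} [Fintype ι] [DecidableEq ι] [Fintype K] [Fintype V] [DecidableEq V]

/-- The product of the matrices `B (x i)` along the letters `i` of the word `f`. -/
def wordProd (B : K → Matrix V V ℝ) {k : ℕ} (f : Fin k → ι) (x : ι → K) : Matrix V V ℝ :=
  ((List.ofFn f).map fun i => B (x i)).prod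

omit [Fintype K] in
lemma trace_sum_smul_pow (B : K → Matrix V V ℝ) (x : ι → K) (y : ι → ℝ) (k : ℕ) :
    ((∑ i, y i • B (x i)) ^ k).trace
      = ∑ f : Fin k → ι, (∏ i, y i ^ letterCount f i) * (wordProd B f x).trace := by
  have h : ∀ l : List ι, (l.map fun i => y i • B (x i)).prod
      = (l.map y).prod • (l.map fun i => B (x i)).prod := by
    intro l
    induction l with
    | nil => simp
    | cons i l ih =>
      simp only [List.map_cons, List.prod_cons, ih]
      rw [smul_mul_assoc, mul_smul_comm, smul_smul]
  rw [sum_pow_eq_sum_word, Matrix.trace_sum]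
  refine Finset.sum_congr rfl fun f _ => ?_
  rw [h, Matrix.trace_smul, smul_eq_mul, ← prod_word_eq_prod_pow, List.map_ofFn, List.prod_ofFn]
  rfl

/-- Termwise bound for the expected trace of a power of a random matrix with independent
marked sub-stochastic summands, in terms of the moments `M i` of the marks. -/
lemma sum_word_moments_le {w : K → ℝ} (hw0 : ∀ a, 0 ≤ w a) (hw : ∑ a, w a = 1)
    {B : K → Matrix V V ℝ} (hB0 : ∀ a u x, 0 ≤ B a u x) (hB1 : ∀ a u, ∑ x, B a u x ≤ 1)
    {ρ : ℝ} (hρ0 : 0 ≤ ρ) (hρ : ∀ u, ∑ a, w a * ∑ x, B a u x ≤ ρ)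
    {M : ι → ℕ → ℝ} {G : ℕ → ℝ} (hG : ∀ j, 0 ≤ G j) (hM0 : ∀ i, |M i 0| ≤ G 0)
    (hM : ∀ i j, j ≠ 0 → ρ * |M i j| ≤ G j) {θ : ℝ} (hθ : 0 < θ) (k : ℕ) :
    ∑ f : Fin k → ι, (∏ i, M i (letterCount f i)) * prodMean w (fun x => (wordProd B f x).trace)
      ≤ Fintype.card V * ((k.factorial : ℝ) / θ ^ k *
        (∑ j ∈ Finset.range (k + 1), G j * θ ^ j / j.factorial) ^ Fintype.card ι) := by
  have hW : ∀ (f : Fin k → ι) (x : ι → K) u v, 0 ≤ wordProd B f x u v := fun f x u v =>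
    list_prod_matrix_nonneg _ (by
      intro A hA; obtain ⟨i, _, rfl⟩ := List.mem_map.1 hA; exact hB0 _) _ _
  -- All entries are nonnegative, so the trace is at most the sum of all entries, to which the row
  -- sum bound applies.
  have hQ : ∀ f : Fin k → ι, prodMean w (fun x => (wordProd B f x).trace)
      ≤ Fintype.card V * ρ ^ (List.ofFn f).toFinset.card := by
    intro f
    have h1 : prodMean w (fun x => (wordProd B f x).trace)
        ≤ prodMean w (fun x => ∑ u, ∑ v, wordProd B f x u v) :=
      prodMean_mono hw0 fun x => Finset.sum_le_sum fun u _ =>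
        Finset.single_le_sum (f := fun v => wordProd B f x u v) (fun v _ => hW f x u v)
          (Finset.mem_univ u)
    refine h1.trans ?_
    rw [prodMean_sum]
    refine (Finset.sum_le_sum fun u _ => prodMean_word_le hw0 hw hB0 hB1 hρ (List.ofFn f) u).trans ?_
    simp
  have hcount : ∀ f : Fin k → ι, (List.ofFn f).toFinset
      = Finset.univ.filter fun i => letterCount f i ≠ 0 := by
    intro f
    ext i
    simp [letterCount, Finset.filter_eq_empty_iff, List.mem_ofFn]
  have hterm : ∀ f : Fin k → ι,
      (∏ i, M i (letterCount f i)) * prodMean w (fun x => (wordProd B f x).trace)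
        ≤ Fintype.card V * ∏ i, G (letterCount f i) := by
    intro f
    have hQ0 : 0 ≤ prodMean w (fun x => (wordProd B f x).trace) :=
      prodMean_nonneg hw0 fun x => Finset.sum_nonneg fun u _ => hW f x u u
    calc (∏ i, M i (letterCount f i)) * prodMean w (fun x => (wordProd B f x).trace)
        ≤ (∏ i, |M i (letterCount f i)|) * (Fintype.card V * ρ ^ (List.ofFn f).toFinset.card) := by
          refine mul_le_mul ?_ (hQ f) hQ0 (Finset.prod_nonneg fun _ _ => abs_nonneg _)
          rw [← Finset.abs_prod]; exact le_abs_self _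
      _ = Fintype.card V *
          ∏ i, (if letterCount f i ≠ 0 then ρ else 1) * |M i (letterCount f i)| := by
          rw [Finset.prod_mul_distrib, Finset.prod_ite, Finset.prod_const, Finset.prod_const_one,
            hcount]
          ring
      _ ≤ Fintype.card V * ∏ i, G (letterCount f i) := by
          refine mul_le_mul_of_nonneg_left (Finset.prod_le_prod ?_ ?_) (by positivity)
          · intro i _; split_ifs <;> positivity
          · intro i _
            split_ifs with h
            · exact hM _ _ h
            · rw [not_not.1 h, one_mul]; exact hM0 i
  refine (Finset.sum_le_sum fun f _ => hterm f).trans ?_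
  rw [← Finset.mul_sum]
  exact mul_le_mul_of_nonneg_left (sum_word_prod_le hG hθ k) (by positivity)

lemma sum_geometric_tail_le {q : ℝ} (h0 : 0 ≤ q) (h1 : q ≤ 1 / 2) (k : ℕ) :
    ∑ j ∈ Finset.range k, q ^ j ≤ 2 := by
  have hs := summable_geometric_of_lt_one h0 (by linarith)
  refine (hs.sum_le_tsum _ fun j _ => pow_nonneg h0 j).trans ?_
  rw [tsum_geometric_of_lt_one h0 (by linarith)]
  calc (1 - q)⁻¹ ≤ (1 / 2)⁻¹ := by gcongr; linarith
    _ = 2 := by norm_num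

/-- The trace moment bound for centred marks whose moments grow at most like those of an
exponential variable. -/
lemma sum_word_subexponential_moments_le {w : K → ℝ} (hw0 : ∀ a, 0 ≤ w a) (hw : ∑ a, w a = 1)
    {B : K → Matrix V V ℝ} (hB0 : ∀ a u x, 0 ≤ B a u x) (hB1 : ∀ a u, ∑ x, B a u x ≤ 1)
    {ρ : ℝ} (hρ0 : 0 ≤ ρ) (hρ : ∀ u, ∑ a, w a * ∑ x, B a u x ≤ ρ)
    {M : ι → ℕ → ℝ} {c : ℝ} (hc : 0 < c) (hM0 : ∀ i, M i 0 = 1) (hM1 : ∀ i, M i 1 = 0)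
    (hM : ∀ i j, |M i j| ≤ Real.exp 1 * c ^ j * j.factorial)
    {θ : ℝ} (hθ : 0 < θ) (hcθ : c * θ ≤ 1 / 2) (k : ℕ) :
    ∑ f : Fin k → ι, (∏ i, M i (letterCount f i)) * prodMean w (fun x => (wordProd B f x).trace)
      ≤ Fintype.card V * ((k.factorial : ℝ) / θ ^ k *
        Real.exp (2 * Real.exp 1 * ρ * (c * θ) ^ 2 * Fintype.card ι)) := by
  -- The value 0 at j = 1 encodes centring. It makes the generating function 1 + O(ρ(cθ)²), with no
  -- linear term, which is the source of Gaussian growth.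
  let G : ℕ → ℝ := fun j =>
    if j = 0 then 1 else if j = 1 then 0 else ρ * (Real.exp 1 * c ^ j * j.factorial)
  have hG : ∀ j, 0 ≤ G j := by
    intro j; simp only [G]; split_ifs <;> positivity
  refine (sum_word_moments_le hw0 hw hB0 hB1 hρ0 hρ hG (M := M) ?_ ?_ hθ k).trans ?_
  · intro i; simp [hM0, G]
  · intro i j hj
    simp only [G, if_neg hj]
    split_ifs with h1
    · simp [h1, hM1]
    · exact mul_le_mul_of_nonneg_left (hM i j) hρ0
  · refine mul_le_mul_of_nonneg_left (mul_le_mul_of_nonneg_left ?_ (by positivity)) (by positivity)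
    have hsum : ∑ j ∈ Finset.range (k + 1), G j * θ ^ j / j.factorial
        ≤ 2 * Real.exp 1 * ρ * (c * θ) ^ 2 + 1 := by
      -- Lengthening the range by two allows the terms j = 0 and j = 1 to be split off even for k =
      -- 0.
      have hle : ∑ j ∈ Finset.range (k + 1), G j * θ ^ j / j.factorial
          ≤ ∑ j ∈ Finset.range (k + 1 + 2), G j * θ ^ j / j.factorial :=
        Finset.sum_le_sum_of_subset_of_nonneg (Finset.range_mono (by omega))
          fun j _ _ => by have := hG j; positivity
      refine hle.trans ?_
      rw [Finset.sum_range_succ', Finset.sum_range_succ']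
      have hj : ∀ j : ℕ, G (j + 1 + 1) * θ ^ (j + 1 + 1) / (j + 1 + 1).factorial
          = ρ * Real.exp 1 * (c * θ) ^ 2 * (c * θ) ^ j := by
        intro j
        have h0 : ((j + 1 + 1).factorial : ℝ) ≠ 0 := by positivity
        simp only [G, if_neg (by omega : ¬ j + 1 + 1 = 0), if_neg (by omega : ¬ j + 1 + 1 = 1)]
        field_simp
        ring
      simp only [hj, ← Finset.mul_sum]
      have := sum_geometric_tail_le (by positivity) hcθ (k + 1)
      have h2 : 0 ≤ ρ * Real.exp 1 * (c * θ) ^ 2 := by positivity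
      have h3 := mul_le_mul_of_nonneg_left this h2
      simp only [G]
      norm_num
      linarith
    calc (∑ j ∈ Finset.range (k + 1), G j * θ ^ j / j.factorial) ^ Fintype.card ι
        ≤ (Real.exp (2 * Real.exp 1 * ρ * (c * θ) ^ 2)) ^ Fintype.card ι :=
          pow_le_pow_left₀ (Finset.sum_nonneg fun j _ => by have := hG j; positivity)
            (hsum.trans (Real.add_one_le_exp _)) _
      _ = _ := by rw [← Real.exp_nat_mul]; ring_nf

/-- Optimised form of the trace moment bound: with `p ≲ n ρ`, the `2p`-th moments are those of a
Gaussian matrix. -/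
lemma sum_word_gaussian_moments_le {w : K → ℝ} (hw0 : ∀ a, 0 ≤ w a) (hw : ∑ a, w a = 1)
    {B : K → Matrix V V ℝ} (hB0 : ∀ a u x, 0 ≤ B a u x) (hB1 : ∀ a u, ∑ x, B a u x ≤ 1)
    {ρ : ℝ} (hρ0 : 0 < ρ) (hρ : ∀ u, ∑ a, w a * ∑ x, B a u x ≤ ρ)
    {M : ι → ℕ → ℝ} {c : ℝ} (hc : 0 < c) (hM0 : ∀ i, M i 0 = 1) (hM1 : ∀ i, M i 1 = 0)
    (hM : ∀ i j, |M i j| ≤ Real.exp 1 * c ^ j * j.factorial)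
    {η : ℝ} (hη : 0 < η) (hη1 : η ≤ 1) {p : ℕ} (hp : 0 < p) (hn : 0 < Fintype.card ι)
    (hpn : η * p ≤ Fintype.card ι * ρ / 4) :
    ∑ f : Fin (2 * p) → ι,
        (∏ i, M i (letterCount f i)) * prodMean w (fun x => (wordProd B f x).trace)
      ≤ Fintype.card V * (4 * Real.exp 6 * c ^ 2 * (Fintype.card ι * ρ) * p / η) ^ p := by
  have hp' : (0 : ℝ) < p := by exact_mod_cast hp
  have hn' : (0 : ℝ) < Fintype.card ι := by exact_mod_cast hn
  set N : ℝ := Fintype.card ι * ρ with hN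
  have hN0 : 0 < N := by positivity
  -- The choice θ = t/c balances θ^(-2p) against the exponential up to constants: the exponent
  -- becomes 2eηp ≤ 6p, and the hypothesis `hpn` is exactly t² ≤ 1/4.
  set t : ℝ := Real.sqrt (η * p / N) with ht
  have ht0 : 0 < t := Real.sqrt_pos.2 (by positivity)
  have ht2 : t ^ 2 = η * p / N := Real.sq_sqrt (by positivity)
  have ht1 : t ≤ 1 / 2 := by
    refine le_of_sq_le_sq ?_ (by norm_num)
    rw [ht2, div_le_iff₀ hN0]; linarith
  have hθ : 0 < t / c := by positivity
  have hcθ : c * (t / c) = t := by field_simp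
  refine (sum_word_subexponential_moments_le hw0 hw hB0 hB1 hρ0.le hρ hc hM0 hM1 hM hθ
    (by rw [hcθ]; exact ht1) (2 * p)).trans ?_
  rw [hcθ]
  refine mul_le_mul_of_nonneg_left ?_ (by positivity)
  have h1 : ((2 * p).factorial : ℝ) ≤ (4 * (p : ℝ) ^ 2) ^ p := by
    have := Nat.factorial_le_pow (2 * p)
    calc ((2 * p).factorial : ℝ) ≤ ((2 * p : ℕ) : ℝ) ^ (2 * p) := by exact_mod_cast this
      _ = (4 * (p : ℝ) ^ 2) ^ p := by rw [pow_mul]; push_cast; ring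
  have h2 : Real.exp (2 * Real.exp 1 * ρ * t ^ 2 * Fintype.card ι) ≤ Real.exp 6 ^ p := by
    rw [← Real.exp_nat_mul]
    refine Real.exp_le_exp.2 ?_
    have h3 : 2 * Real.exp 1 * ρ * t ^ 2 * Fintype.card ι = 2 * Real.exp 1 * (η * p) := by
      rw [ht2, hN]; field_simp
    rw [h3]
    have he : Real.exp 1 ≤ 3 := by have := Real.exp_one_lt_d9; linarith
    have : η * p ≤ p := by nlinarith
    have h4 : 0 ≤ η * p := by positivity
    nlinarith
  have h3 : (t / c) ^ (2 * p) = (η * p / N / c ^ 2) ^ p := by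
    rw [pow_mul, div_pow, ht2]
  rw [h3]
  calc ((2 * p).factorial : ℝ) / (η * p / N / c ^ 2) ^ p * _
      ≤ (4 * (p : ℝ) ^ 2) ^ p / (η * p / N / c ^ 2) ^ p * Real.exp 6 ^ p := by gcongr
    _ = (4 * Real.exp 6 * c ^ 2 * N * p / η) ^ p := by
        rw [← div_pow, ← mul_pow]
        congr 1
        field_simp

end TraceMoments

/-! ### Indicator matrices and the positions they encode. -/

section Positions

variable {m₁ m₂ : ℕ}

/-- The dilation of the indicator matrix of a position. -/
def dilatedIndicator (a : Fin m₁ × Fin m₂) : Matrix (Fin m₁ ⊕ Fin m₂) (Fin m₁ ⊕ Fin m₂) ℝ :=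
  dilation (Matrix.single a.1 a.2 1)

lemma sum_smul_dilatedIndicator {ι : Type*} [Fintype ι] (x : ι → Fin m₁ × Fin m₂) (y : ι → ℝ) :
    ∑ i, y i • dilatedIndicator (x i)
      = dilation (∑ i, y i • Matrix.single (x i).1 (x i).2 (1 : ℝ)) := by
  ext (u | u) (v | v) <;>
    simp [dilatedIndicator, dilation, Matrix.sum_apply, Matrix.single_apply, and_comm]

lemma dilatedIndicator_nonneg (a : Fin m₁ × Fin m₂) (u v) : 0 ≤ dilatedIndicator a u v := by
  rcases u with u | u <;> rcases v with v | v <;>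
    simp only [dilatedIndicator, dilation, Matrix.fromBlocks_apply₁₁, Matrix.fromBlocks_apply₁₂,
      Matrix.fromBlocks_apply₂₁, Matrix.fromBlocks_apply₂₂, Matrix.zero_apply, le_refl,
      Matrix.transpose_apply, Matrix.single_apply] <;>
    split_ifs <;> norm_num

lemma sum_dilatedIndicator_inl (a : Fin m₁ × Fin m₂) (k : Fin m₁) :
    ∑ v, dilatedIndicator a (Sum.inl k) v = if a.1 = k then 1 else 0 := by
  simp [dilatedIndicator, dilation, Matrix.single_apply, ite_and]

lemma sum_dilatedIndicator_inr (a : Fin m₁ × Fin m₂) (l : Fin m₂) :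
    ∑ v, dilatedIndicator a (Sum.inr l) v = if a.2 = l then 1 else 0 := by
  simp [dilatedIndicator, dilation, Matrix.single_apply, ite_and]

lemma sum_dilatedIndicator_le_one (a : Fin m₁ × Fin m₂) (u) :
    ∑ v, dilatedIndicator a u v ≤ 1 := by
  rcases u with u | u
  · rw [sum_dilatedIndicator_inl]; split_ifs <;> norm_num
  · rw [sum_dilatedIndicator_inr]; split_ifs <;> norm_num

/-- A mean row sum of the dilated indicator is a row or a column marginal of the sampling law. This
identifies the ρ of the word bound as L / min(m₁,m₂). -/
lemma sum_mul_sum_dilatedIndicator_le {p : Fin m₁ → Fin m₂ → ℝ} {L : ℝ} (hp : MarginalBound p L)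
    (u) : ∑ a : Fin m₁ × Fin m₂, p a.1 a.2 * ∑ v, dilatedIndicator a u v
      ≤ L / (min m₁ m₂ : ℕ) := by
  rcases u with u | u
  · simp only [sum_dilatedIndicator_inl, Fintype.sum_prod_type]
    refine le_trans (le_of_eq ?_) (hp.1 u)
    rw [Finset.sum_eq_single u] <;> simp +contextual
  · simp only [sum_dilatedIndicator_inr, Fintype.sum_prod_type]
    refine le_trans (le_of_eq ?_) (hp.2 u)
    simp

lemma single_one_injective {a b : Fin m₁ × Fin m₂}
    (h : Matrix.single a.1 a.2 (1 : ℝ) = Matrix.single b.1 b.2 1) : a = b := by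
  have h1 := congrFun (congrFun h a.1) a.2
  rw [Matrix.single_apply_same, Matrix.single_apply] at h1
  split_ifs at h1 with h2
  · exact Prod.ext h2.1.symm h2.2.symm
  · norm_num at h1

instance : MeasurableSingletonClass (Matrix (Fin m₁) (Fin m₂) ℝ) :=
  inferInstanceAs (MeasurableSingletonClass (Fin m₁ → Fin m₂ → ℝ))

open Classical in
/-- The position of the nonzero entry of an indicator matrix (and `a₀` for other matrices). -/
noncomputable def position (a₀ : Fin m₁ × Fin m₂) (T : Matrix (Fin m₁) (Fin m₂) ℝ) :
    Fin m₁ × Fin m₂ :=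
  if h : ∃ a : Fin m₁ × Fin m₂, T = Matrix.single a.1 a.2 1 then h.choose else a₀

lemma position_single (a₀ a : Fin m₁ × Fin m₂) :
    position a₀ (Matrix.single a.1 a.2 1) = a := by
  have h : ∃ b : Fin m₁ × Fin m₂, Matrix.single a.1 a.2 (1 : ℝ) = Matrix.single b.1 b.2 1 :=
    ⟨a, rfl⟩
  rw [position, dif_pos h]
  exact (single_one_injective h.choose_spec).symm

lemma measurable_position (a₀ : Fin m₁ × Fin m₂) : Measurable (position a₀) := by
  have hne : ∀ a, a ≠ a₀ → position a₀ ⁻¹' {a} = {Matrix.single a.1 a.2 1} := by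
    intro a ha
    ext T
    simp only [Set.mem_preimage, Set.mem_singleton_iff]
    constructor
    · intro h
      rw [position] at h
      split_ifs at h with h1
      · rw [← h]; exact h1.choose_spec
      · exact absurd h.symm ha
    · rintro rfl; exact position_single _ _
  refine measurable_to_countable' fun a => ?_
  by_cases ha : a = a₀
  -- The fibre over the default value also contains every matrix that is not an indicator, so it is
  -- described as the complement of the other fibres, which are singletons.
  · have : position a₀ ⁻¹' {a} = (⋃ b ∈ {b | b ≠ a₀}, position a₀ ⁻¹' {b})ᶜ := by
      ext T
      simp only [ha, Set.mem_preimage, Set.mem_singleton_iff, Set.mem_compl_iff, Set.mem_iUnion,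
        Set.mem_ofPred_eq, not_exists]
      constructor
      · intro h b hb hb'
        exact hb (hb' ▸ h)
      · intro h
        by_contra h'
        exact h _ h' rfl
    rw [this]
    refine (MeasurableSet.biUnion (Set.to_countable _) fun b hb => ?_).compl
    rw [hne b hb]; exact measurableSet_singleton _
  · rw [hne a ha]; exact measurableSet_singleton _

end Positions

/-! ### Independent points with marks: factorisation of mixed moments. -/

section MarkedSample

variable {ι K Ω : Type*} [Fintype ι] [DecidableEq ι] [Fintype K] [DecidableEq K]
  [MeasurableSpace K] [MeasurableSingletonClass K] [MeasurableSpace Ω]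

/-- Independent points `x i` with common law `w`, carrying marks `ξ i` independent of them. -/
structure IsMarkedSample (μ : Measure Ω) (w : K → ℝ) (x : ι → Ω → K) (ξ : ι → Ω → ℝ) : Prop where
  measurable_point : ∀ i, Measurable (x i)
  measurable_mark : ∀ i, Measurable (ξ i)
  law : ∀ i a, μ.real {ω | x i ω = a} = w a
  indep_pairs : iIndepFun (fun i ω => (x i ω, ξ i ω)) μ
  indep_mark : ∀ i, IndepFun (x i) (ξ i) μ
  integrable_pow : ∀ i k, Integrable (fun ω => ξ i ω ^ k) μ

variable {μ : Measure Ω} [IsProbabilityMeasure μ] {w : K → ℝ} {x : ι → Ω → K} {ξ : ι → Ω → ℝ}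

namespace IsMarkedSample

omit [Fintype ι] [DecidableEq ι] [Fintype K] [DecidableEq K] [MeasurableSingletonClass K]
  [IsProbabilityMeasure μ] in
lemma weight_nonneg (h : IsMarkedSample μ w x ξ) (i : ι) (a : K) : 0 ≤ w a := by
  rw [← h.law i a]; exact measureReal_nonneg

omit [Fintype ι] [DecidableEq ι] [DecidableEq K] in
lemma sum_weight (h : IsMarkedSample μ w x ξ) (i : ι) : ∑ a, w a = 1 := by
  simp only [← h.law i]
  have := sum_measureReal_preimage_singleton (μ := μ) (f := x i) Finset.univ
    (fun a _ => h.measurable_point i (measurableSet_singleton a))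
  simpa [Set.preimage] using this

omit [Fintype ι] [DecidableEq ι] [Fintype K] [IsProbabilityMeasure μ] in
lemma integral_indicator_mul_pow (h : IsMarkedSample μ w x ξ) (i : ι) (a : K) (k : ℕ) :
    ∫ ω, (if x i ω = a then 1 else 0) * ξ i ω ^ k ∂μ = w a * ∫ ω, ξ i ω ^ k ∂μ := by
  have hf : Measurable fun b : K => if b = a then (1 : ℝ) else 0 :=
    Measurable.ite (measurableSet_singleton a) measurable_const measurable_const
  rw [(h.indep_mark i).integral_fun_comp_mul_comp (f := fun b => if b = a then (1 : ℝ) else 0)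
    (g := fun y => y ^ k) (h.measurable_point i).aemeasurable (h.measurable_mark i).aemeasurable
    hf.aestronglyMeasurable (by fun_prop)]
  congr 1
  have hs : MeasurableSet {ω | x i ω = a} := h.measurable_point i (measurableSet_singleton a)
  rw [← h.law i a, ← integral_indicator_one hs]
  refine integral_congr_ae (Filter.Eventually.of_forall fun ω => ?_)
  simp [Set.indicator_apply]

omit [DecidableEq ι] [Fintype K] in
lemma integrable_prod (h : IsMarkedSample μ w x ξ) (m : ι → ℕ) (v : ι → K) :
    Integrable (fun ω => ∏ i, ((if x i ω = v i then 1 else 0) * ξ i ω ^ m i)) μ := by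
  have hX : ∀ i, Measurable fun ω => (x i ω, ξ i ω) := fun i =>
    (h.measurable_point i).prodMk (h.measurable_mark i)
  let F : ι → K × ℝ → ℝ := fun i q => (if q.1 = v i then 1 else 0) * q.2 ^ m i
  have hF : ∀ i, Measurable (F i) := fun i =>
    (Measurable.ite (measurable_fst (measurableSet_singleton (v i))) measurable_const
      measurable_const).mul (measurable_snd.pow_const _)
  have hint : ∀ i, Integrable (F i) (μ.map fun ω => (x i ω, ξ i ω)) := by
    intro i
    rw [integrable_map_measure (hF i).aestronglyMeasurable (hX i).aemeasurable]
    refine (h.integrable_pow i (m i)).mono ((hF i).comp (hX i)).aestronglyMeasurable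
      (Filter.Eventually.of_forall fun ω => ?_)
    simp only [F, Function.comp]
    split_ifs <;> simp
  have hprob : ∀ i, IsProbabilityMeasure (μ.map fun ω => (x i ω, ξ i ω)) := fun i =>
    Measure.isProbabilityMeasure_map (hX i).aemeasurable
  have hpi := Integrable.fintype_prod_dep hint
  rw [← h.indep_pairs.map_fun_eq_pi_map fun i => (hX i).aemeasurable] at hpi
  exact hpi.comp_measurable (measurable_pi_lambda _ hX)

omit [DecidableEq ι] [Fintype K] [IsProbabilityMeasure μ] in
lemma integral_prod (h : IsMarkedSample μ w x ξ) (m : ι → ℕ) (v : ι → K) :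
    ∫ ω, ∏ i, ((if x i ω = v i then 1 else 0) * ξ i ω ^ m i) ∂μ
      = (∏ i, ∫ ω, ξ i ω ^ m i ∂μ) * ∏ i, w (v i) := by
  have hX : ∀ i, Measurable fun ω => (x i ω, ξ i ω) := fun i =>
    (h.measurable_point i).prodMk (h.measurable_mark i)
  let F : ι → K × ℝ → ℝ := fun i q => (if q.1 = v i then 1 else 0) * q.2 ^ m i
  have hF : ∀ i, Measurable (F i) := fun i =>
    (Measurable.ite (measurable_fst (measurableSet_singleton (v i))) measurable_const
      measurable_const).mul (measurable_snd.pow_const _)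
  have := h.indep_pairs.integral_fun_prod_comp (f := F) (fun i => (hX i).aemeasurable)
    fun i => (hF i).aestronglyMeasurable
  refine this.trans ?_
  rw [← Finset.prod_mul_distrib]
  refine Finset.prod_congr rfl fun i _ => ?_
  rw [mul_comm]
  exact h.integral_indicator_mul_pow i (v i) (m i)

-- As K is finite, any function of all the points is a combination of indicators of configurations.
-- Each resulting term is a product over i, so independence of the pairs applies to it.
omit [MeasurableSpace K] [MeasurableSingletonClass K] in
lemma prod_pow_mul_eq (m : ι → ℕ) (Q : (ι → K) → ℝ) (y : ι → ℝ) (z : ι → K) :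
    (∏ i, y i ^ m i) * Q z
      = ∑ v, Q v * ∏ i, ((if z i = v i then 1 else 0) * y i ^ m i) := by
  rw [Finset.sum_eq_single z]
  · simp [mul_comm]
  · intro v _ hv
    obtain ⟨i, hi⟩ := Function.ne_iff.1 hv
    rw [Finset.prod_eq_zero (Finset.mem_univ i), mul_zero]
    rw [if_neg (Ne.symm hi), zero_mul]
  · simp

lemma integrable_pow_mul (h : IsMarkedSample μ w x ξ) (m : ι → ℕ) (Q : (ι → K) → ℝ) :
    Integrable (fun ω => (∏ i, ξ i ω ^ m i) * Q (fun i => x i ω)) μ := by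
  simp only [prod_pow_mul_eq m Q]
  exact integrable_finsetSum _ fun v _ => (h.integrable_prod m v).const_mul _

/-- Mixed moments of the marks and functions of the points factorise. -/
lemma integral_pow_mul (h : IsMarkedSample μ w x ξ) (m : ι → ℕ) (Q : (ι → K) → ℝ) :
    ∫ ω, (∏ i, ξ i ω ^ m i) * Q (fun i => x i ω) ∂μ
      = (∏ i, ∫ ω, ξ i ω ^ m i ∂μ) * prodMean w Q := by
  simp only [prod_pow_mul_eq m Q]
  rw [integral_finsetSum _ fun v _ => (h.integrable_prod m v).const_mul _, prodMean,
    Finset.mul_sum]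
  refine Finset.sum_congr rfl fun v _ => ?_
  rw [integral_const_mul, h.integral_prod]
  ring

-- This is the factorisation with all exponents zero. It turns the probability of an event about
-- positions into a finite weighted sum, where the symmetrisation argument takes place.
open Classical in
lemma measureReal_mem (h : IsMarkedSample μ w x ξ) (S : Set (ι → K)) :
    μ.real {ω | (fun i => x i ω) ∈ S} = prodMean w (fun v => if v ∈ S then 1 else 0) := by
  have hm : MeasurableSet {ω | (fun i => x i ω) ∈ S} :=
    measurable_pi_lambda _ h.measurable_point (Set.toFinite S).measurableSet
  rw [← integral_indicator_one hm]
  have := h.integral_pow_mul (fun _ => 0) (fun v => if v ∈ S then 1 else 0)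
  simp only [pow_zero, Finset.prod_const_one, one_mul, integral_const, probReal_univ, smul_eq_mul,
    mul_one] at this
  rw [← this]
  refine integral_congr_ae (Filter.Eventually.of_forall fun ω => ?_)
  simp [Set.indicator_apply]

variable {V : Type*} [Fintype V] [DecidableEq V]

lemma integrable_trace_pow (h : IsMarkedSample μ w x ξ) (B : K → Matrix V V ℝ) (k : ℕ) :
    Integrable (fun ω => ((∑ i, ξ i ω • B (x i ω)) ^ k).trace) μ := by
  have : ∀ ω, ((∑ i, ξ i ω • B (x i ω)) ^ k).trace = _ := fun ω =>
    trace_sum_smul_pow B (fun i => x i ω) (fun i => ξ i ω) k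
  simp only [this]
  exact integrable_finsetSum _ fun f _ =>
    h.integrable_pow_mul (letterCount f) (fun v => (wordProd B f v).trace)

lemma integral_trace_pow (h : IsMarkedSample μ w x ξ) (B : K → Matrix V V ℝ) (k : ℕ) :
    ∫ ω, ((∑ i, ξ i ω • B (x i ω)) ^ k).trace ∂μ
      = ∑ f : Fin k → ι, (∏ i, ∫ ω, ξ i ω ^ letterCount f i ∂μ) *
          prodMean w (fun v => (wordProd B f v).trace) := by
  have : ∀ ω, ((∑ i, ξ i ω • B (x i ω)) ^ k).trace = _ := fun ω =>
    trace_sum_smul_pow B (fun i => x i ω) (fun i => ξ i ω) k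
  simp only [this]
  rw [integral_finsetSum _ fun f _ =>
    h.integrable_pow_mul (letterCount f) (fun v => (wordProd B f v).trace)]
  exact Finset.sum_congr rfl fun f _ =>
    h.integral_pow_mul (letterCount f) (fun v => (wordProd B f v).trace)

end IsMarkedSample

end MarkedSample

/-! ### Moments of sub-exponential noise, and the regression model as a marked sample. -/

section Noise

variable {Ω : Type*} [MeasurableSpace Ω] {μ : Measure Ω} [IsProbabilityMeasure μ]

lemma abs_pow_le_exp {c : ℝ} (hc : 0 < c) (y : ℝ) (k : ℕ) :
    |y ^ k| ≤ c ^ k * k.factorial * Real.exp (|y| / c) := by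
  have h := Real.pow_div_factorial_le_exp (|y| / c) (by positivity) k
  rw [div_le_iff₀ (by positivity), div_pow, div_le_iff₀ (by positivity)] at h
  rw [abs_pow]
  linarith

omit [IsProbabilityMeasure μ] in
lemma integrable_pow_of_exp {c : ℝ} (hc : 0 < c) {ξ : Ω → ℝ} (hm : Measurable ξ)
    (h : Integrable (fun ω => Real.exp (|ξ ω| / c)) μ) (k : ℕ) :
    Integrable (fun ω => ξ ω ^ k) μ := by
  refine (h.const_mul (c ^ k * k.factorial)).mono' (by fun_prop)
    (Filter.Eventually.of_forall fun ω => ?_)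
  exact abs_pow_le_exp hc _ _

omit [IsProbabilityMeasure μ] in
lemma abs_integral_pow_le {c : ℝ} (hc : 0 < c) {ξ : Ω → ℝ} (hm : Measurable ξ)
    (h : Integrable (fun ω => Real.exp (|ξ ω| / c)) μ)
    (he : ∫ ω, Real.exp (|ξ ω| / c) ∂μ ≤ Real.exp 1) (k : ℕ) :
    |∫ ω, ξ ω ^ k ∂μ| ≤ Real.exp 1 * c ^ k * k.factorial := by
  have hi := integrable_pow_of_exp hc hm h k
  calc |∫ ω, ξ ω ^ k ∂μ| ≤ ∫ ω, |ξ ω ^ k| ∂μ := abs_integral_le_integral_abs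
    _ ≤ ∫ ω, c ^ k * k.factorial * Real.exp (|ξ ω| / c) ∂μ :=
        integral_mono hi.abs (h.const_mul _) fun ω => abs_pow_le_exp hc _ _
    _ = c ^ k * k.factorial * ∫ ω, Real.exp (|ξ ω| / c) ∂μ := integral_const_mul _ _
    _ ≤ c ^ k * k.factorial * Real.exp 1 := by gcongr
    _ = _ := by ring

variable {m₁ m₂ n : ℕ}

omit [IsProbabilityMeasure μ] in
lemma IsTraceRegression.ae_eq_single {p : Fin m₁ → Fin m₂ → ℝ}
    {T : Fin n → Ω → Matrix (Fin m₁) (Fin m₂) ℝ} {ξ : Fin n → Ω → ℝ}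
    (h : IsTraceRegression μ p T ξ) (a₀ : Fin m₁ × Fin m₂) :
    ∀ᵐ ω ∂μ, ∀ i, T i ω
      = Matrix.single (position a₀ (T i ω)).1 (position a₀ (T i ω)).2 1 := by
  rw [ae_all_iff]
  intro i
  filter_upwards [(h.law i).mem_indicators] with ω hω
  obtain ⟨k, l, hkl⟩ := hω
  rw [hkl, position_single a₀ (k, l)]

omit [IsProbabilityMeasure μ] in
lemma IsTraceRegression.measureReal_position_eq {p : Fin m₁ → Fin m₂ → ℝ}
    {T : Fin n → Ω → Matrix (Fin m₁) (Fin m₂) ℝ} {ξ : Fin n → Ω → ℝ}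
    (h : IsTraceRegression μ p T ξ) (a₀ a : Fin m₁ × Fin m₂) (i : Fin n) :
    μ.real {ω | position a₀ (T i ω) = a} = p a.1 a.2 := by
  rw [← (h.law i).prob_eq]
  refine measureReal_congr ?_
  filter_upwards [h.ae_eq_single a₀] with ω hω
  have hiff : position a₀ (T i ω) = a ↔ T i ω = Matrix.single a.1 a.2 1 := by
    constructor
    · intro h; rw [hω i, h]
    · intro h; rw [h, position_single]
  exact propext hiff

omit [IsProbabilityMeasure μ] in
lemma IsTraceRegression.isMarkedSample {p : Fin m₁ → Fin m₂ → ℝ}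
    {T : Fin n → Ω → Matrix (Fin m₁) (Fin m₂) ℝ} {ξ : Fin n → Ω → ℝ} {c : ℝ} (hc : 0 < c)
    (h : IsTraceRegression μ p T ξ) (hξ : SubExponentialNoise μ ξ c) (a₀ : Fin m₁ × Fin m₂) :
    IsMarkedSample μ (fun a => p a.1 a.2) (fun i ω => position a₀ (T i ω)) ξ := by
  have hpos : Measurable (position a₀) := measurable_position a₀
  have hlaw := h.measureReal_position_eq a₀
  generalize position a₀ = f at hpos hlaw ⊢
  exact ⟨fun i => hpos.comp (h.law i).measurable, h.noise_measurable, fun i a => hlaw a i,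
    h.indep_pairs.comp (fun _ => fun q : Matrix (Fin m₁) (Fin m₂) ℝ × ℝ => (f q.1, q.2)) fun _ =>
      (hpos.comp measurable_fst).prodMk measurable_snd,
    fun i => (h.indep_noise i).comp (ψ := id) hpos measurable_id,
    fun i k => integrable_pow_of_exp hc (h.noise_measurable i) (hξ i).1 k⟩

end Noise

/-! ### Random signs and the contraction principle. -/

section Rademacher

variable {ι τ : Type*} [Fintype ι] [DecidableEq ι] [Finite τ] [Nonempty τ]

/-- The sign encoded by a Boolean. -/
def boolSign (b : Bool) : ℝ := if b then 1 else -1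

/-- The mean over uniform random signs. -/
noncomputable def signMean (F : (ι → Bool) → ℝ) : ℝ := prodMean (fun _ => 1 / 2) F

lemma boolSign_not (b : Bool) : boolSign (!b) = -boolSign b := by cases b <;> simp [boolSign]

lemma abs_boolSign (b : Bool) : |boolSign b| = 1 := by cases b <;> simp [boolSign]

lemma signMean_mono {F G : (ι → Bool) → ℝ} (h : ∀ ε, F ε ≤ G ε) : signMean F ≤ signMean G :=
  prodMean_mono (fun _ => by norm_num) h

lemma signMean_const (c : ℝ) : signMean (ι := ι) (fun _ => c) = c :=
  prodMean_const (by simp) c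

lemma signMean_not (F : (ι → Bool) → ℝ) : signMean (fun ε => F fun i => !(ε i)) = signMean F := by
  have hinv : Function.Involutive fun (ε : ι → Bool) i => !(ε i) := fun ε => by simp
  simp only [signMean, prodMean, Finset.prod_const]
  exact Equiv.sum_comp hinv.toPerm fun ε => (1 / 2 : ℝ) ^ (Finset.univ : Finset ι).card * F ε

/-- This is contraction for a single sign. If s and t attain the two suprema on the left, that side
is at most g s + g t + |b s - b t|, and the sign of b s - b t decides which of s, t to test in which
supremum on the right. -/
lemma iSup_add_iSup_sub_le (g : τ → ℝ) {a b : τ → ℝ} (h : ∀ s t, |a s - a t| ≤ |b s - b t|) :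
    (⨆ t, (g t + a t)) + ⨆ t, (g t - a t) ≤ (⨆ t, (g t + b t)) + ⨆ t, (g t - b t) := by
  obtain ⟨s, hs⟩ := exists_eq_ciSup_of_finite (f := fun t => g t + a t)
  obtain ⟨t, ht⟩ := exists_eq_ciSup_of_finite (f := fun t => g t - a t)
  rw [← hs, ← ht]
  have hp : ∀ u, g u + b u ≤ ⨆ t, (g t + b t) := le_ciSup (Set.finite_range _).bddAbove
  have hm : ∀ u, g u - b u ≤ ⨆ t, (g t - b t) := le_ciSup (Set.finite_range _).bddAbove
  have h1 := (le_abs_self _).trans (h s t)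
  rcases abs_cases (b s - b t) with h2 | h2
  · have := hp s; have := hm t; linarith
  · have := hp t; have := hm s; linarith

/-- The contraction principle for Rademacher processes over a finite index set. -/
lemma signMean_iSup_le_of_contraction (f : τ → ℝ) {a b : ι → τ → ℝ}
    (h : ∀ i s t, |a i s - a i t| ≤ |b i s - b i t|) :
    signMean (fun ε => ⨆ t, (f t + ∑ i, boolSign (ε i) * a i t))
      ≤ signMean (fun ε => ⨆ t, (f t + ∑ i, boolSign (ε i) * b i t)) := by
  -- The coordinates are replaced one at a time, and S collects those already replaced. Resampling
  -- the sign at j isolates that coordinate and reduces the step to the single-sign case.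
  have key : ∀ S : Finset ι, signMean (fun ε => ⨆ t, (f t + ∑ i, boolSign (ε i) * a i t))
      ≤ signMean (fun ε => ⨆ t, (f t + ∑ i, boolSign (ε i) * (if i ∈ S then b i t else a i t))) := by
    intro S
    induction S using Finset.induction_on with
    | empty => simp
    | insert j S hj ih =>
      refine ih.trans ?_
      simp only [signMean]
      rw [← prodMean_resample (w := fun _ : Bool => (1 / 2 : ℝ)) (by simp) j
          (fun ε => ⨆ t, (f t + ∑ i, boolSign (ε i) * (if i ∈ S then b i t else a i t))),
        ← prodMean_resample (w := fun _ : Bool => (1 / 2 : ℝ)) (by simp) j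
          (fun ε => ⨆ t, (f t + ∑ i, boolSign (ε i) * (if i ∈ insert j S then b i t else a i t)))]
      refine prodMean_mono (fun _ => by norm_num) fun ε => ?_
      set g : τ → ℝ := fun t => f t + ∑ i ∈ Finset.univ.erase j,
        boolSign (ε i) * (if i ∈ S then b i t else a i t) with hg
      have h1 : ∀ c t, f t + ∑ i, boolSign (Function.update ε j c i) *
          (if i ∈ S then b i t else a i t) = g t + boolSign c * a j t := by
        intro c t
        rw [← Finset.add_sum_erase Finset.univ _ (Finset.mem_univ j), Function.update_self,
          if_neg hj, hg, Finset.sum_congr rfl (g := fun i => boolSign (ε i) *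
            (if i ∈ S then b i t else a i t))]
        · ring
        · intro i hi
          rw [Function.update_of_ne (Finset.ne_of_mem_erase hi)]
      have h2 : ∀ c t, f t + ∑ i, boolSign (Function.update ε j c i) *
          (if i ∈ insert j S then b i t else a i t) = g t + boolSign c * b j t := by
        intro c t
        rw [← Finset.add_sum_erase Finset.univ _ (Finset.mem_univ j), Function.update_self,
          if_pos (Finset.mem_insert_self j S), hg, Finset.sum_congr rfl (g := fun i =>
            boolSign (ε i) * (if i ∈ S then b i t else a i t))]
        · ring
        · intro i hi
          have hne := Finset.ne_of_mem_erase hi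
          rw [Function.update_of_ne hne]
          simp [Finset.mem_insert, hne]
      simp only [h1, h2]
      simp only [Fintype.sum_bool, boolSign]
      have := iSup_add_iSup_sub_le g (h j)
      simp only [if_true, one_mul, Bool.false_eq_true, if_false, neg_one_mul, ← sub_eq_add_neg]
      linarith
  have := key Finset.univ
  simpa using this

end Rademacher

/-! ### Symmetrisation with a second independent copy. -/

section Symmetrization

variable {ι K τ : Type*} [Fintype ι] [DecidableEq ι] [Fintype K] [Finite τ] [Nonempty τ]

lemma prodMean_comm {K' : Type*} [Fintype K'] (w : K → ℝ) (w' : K' → ℝ)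
    (F : (ι → K) → (ι → K') → ℝ) :
    prodMean w (fun x => prodMean w' fun y => F x y)
      = prodMean w' (fun y => prodMean w fun x => F x y) := by
  simp only [prodMean, Finset.mul_sum]
  rw [Finset.sum_comm]
  exact Finset.sum_congr rfl fun _ _ => Finset.sum_congr rfl fun _ _ => by ring

lemma prodMean_eval {w : K → ℝ} (hw : ∑ a, w a = 1) (h : K → ℝ) (i : ι) :
    prodMean w (fun x => h (x i)) = ∑ a, w a * h a := by
  rw [← prodMean_resample hw i]
  simp only [Function.update_self]
  exact prodMean_const hw _

lemma iSup_prodMean_le {w : K → ℝ} (hw : ∀ a, 0 ≤ w a) (F : τ → (ι → K) → ℝ) :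
    ⨆ t, prodMean w (F t) ≤ prodMean w fun x => ⨆ t, F t x :=
  ciSup_le fun t => prodMean_mono hw fun x =>
    le_ciSup (f := fun t => F t x) (Set.finite_range _).bddAbove t

/-- Exchanging the coordinates of two independent copies where `ε` is false preserves means. -/
lemma prodMean_swap (w : K → ℝ) (ε : ι → Bool) (F : (ι → K) → (ι → K) → ℝ) :
    prodMean w (fun x => prodMean w fun y =>
        F (fun i => if ε i then x i else y i) fun i => if ε i then y i else x i)
      = prodMean w fun x => prodMean w fun y => F x y := by
  let e : (ι → K) × (ι → K) → (ι → K) × (ι → K) := fun q =>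
    (fun i => if ε i then q.1 i else q.2 i, fun i => if ε i then q.2 i else q.1 i)
  have he : Function.Involutive e := by
    rintro ⟨x, y⟩
    refine Prod.ext (funext fun i => ?_) (funext fun i => ?_) <;>
      by_cases h : ε i <;> simp [e, h]
  have hwt : ∀ q : (ι → K) × (ι → K), (∏ i, w ((e q).1 i)) * ∏ i, w ((e q).2 i)
      = (∏ i, w (q.1 i)) * ∏ i, w (q.2 i) := by
    intro q
    rw [← Finset.prod_mul_distrib, ← Finset.prod_mul_distrib]
    refine Finset.prod_congr rfl fun i _ => ?_
    by_cases h : ε i <;> simp [e, h, mul_comm]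
  have hsum : ∀ G : (ι → K) → (ι → K) → ℝ, prodMean w (fun x => prodMean w fun y => G x y)
      = ∑ q : (ι → K) × (ι → K), ((∏ i, w (q.1 i)) * ∏ i, w (q.2 i)) * G q.1 q.2 := by
    intro G
    simp only [prodMean, Fintype.sum_prod_type, Finset.mul_sum, mul_assoc]
  rw [hsum, hsum]
  refine Eq.trans (Finset.sum_congr rfl fun q _ => ?_) (Equiv.sum_comp he.toPerm
    fun q => ((∏ i, w (q.1 i)) * ∏ i, w (q.2 i)) * F q.1 q.2)
  change _ = (∏ i, w ((e q).1 i)) * (∏ i, w ((e q).2 i)) * F (e q).1 (e q).2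
  rw [hwt]

/-- Symmetrisation of a penalised empirical process over a finite index set. -/
lemma prodMean_iSup_le_signMean {w : K → ℝ} (hw0 : ∀ a, 0 ≤ w a) (hw : ∑ a, w a = 1)
    (f : τ → ℝ) (h : τ → K → ℝ) :
    prodMean w (fun x : ι → K => ⨆ t, (f t + ∑ i, ((∑ a, w a * h t a) - h t (x i))))
      ≤ prodMean w fun x : ι → K =>
        signMean fun ε => ⨆ t, (f t + ∑ i, boolSign (ε i) * (2 * h t (x i))) := by
  set Φ : (ι → K) → (ι → K) → ℝ := fun x y => ⨆ t, (f t + ∑ i, (h t (y i) - h t (x i))) with hΦ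
  set Ψ : (ι → Bool) → (ι → K) → ℝ :=
    fun ε x => ⨆ t, (f t + ∑ i, boolSign (ε i) * (2 * h t (x i))) with hΨ
  have h1 : prodMean w (fun x : ι → K => ⨆ t, (f t + ∑ i, ((∑ a, w a * h t a) - h t (x i))))
      ≤ prodMean w fun x => prodMean w fun y => Φ x y := by
    refine prodMean_mono hw0 fun x => ?_
    refine le_trans (le_of_eq ?_)
      (iSup_prodMean_le hw0 fun t (y : ι → K) => f t + ∑ i, (h t (y i) - h t (x i)))
    congr 1
    ext t
    rw [prodMean_add, prodMean_const hw, prodMean_sum]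
    congr 1
    refine Finset.sum_congr rfl fun i _ => ?_
    simp only [sub_eq_add_neg]
    rw [prodMean_add, prodMean_const hw, prodMean_eval hw (h t) i]
  -- After swapping, the difference splits into a sign process on y and one with the opposite signs
  -- on x. Giving half of f to each explains the factor 2 on h, and the two halves have equal means
  -- because flipping all signs preserves `signMean`.
  have hpt : ∀ (ε : ι → Bool) (x y : ι → K),
      Φ (fun i => if ε i then x i else y i) (fun i => if ε i then y i else x i)
        ≤ 1 / 2 * Ψ ε y + 1 / 2 * Ψ (fun i => !(ε i)) x := by
    intro ε x y
    refine ciSup_le fun t => ?_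
    have hy : f t + ∑ i, boolSign (ε i) * (2 * h t (y i)) ≤ Ψ ε y :=
      le_ciSup (f := fun t => f t + ∑ i, boolSign (ε i) * (2 * h t (y i)))
        (Set.finite_range _).bddAbove t
    have hx : f t + ∑ i, boolSign (!(ε i)) * (2 * h t (x i)) ≤ Ψ (fun i => !(ε i)) x :=
      le_ciSup (f := fun t => f t + ∑ i, boolSign (!(ε i)) * (2 * h t (x i)))
        (Set.finite_range _).bddAbove t
    have heq : ∑ i, (h t (if ε i then y i else x i) - h t (if ε i then x i else y i))
        = 1 / 2 * (∑ i, boolSign (ε i) * (2 * h t (y i)))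
          + 1 / 2 * ∑ i, boolSign (!(ε i)) * (2 * h t (x i)) := by
      rw [Finset.mul_sum, Finset.mul_sum, ← Finset.sum_add_distrib]
      refine Finset.sum_congr rfl fun i _ => ?_
      rw [boolSign_not]
      by_cases hε : ε i <;> simp [hε, boolSign] <;> ring
    rw [heq]
    linarith
  have h2 : prodMean w (fun x => prodMean w fun y => Φ x y)
      = signMean fun ε => prodMean w fun x => prodMean w fun y =>
        Φ (fun i => if ε i then x i else y i) fun i => if ε i then y i else x i := by
    simp only [prodMean_swap w _ Φ]
    rw [signMean_const]
  have h3 : (signMean fun ε => prodMean w fun x => prodMean w fun y =>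
        Φ (fun i => if ε i then x i else y i) fun i => if ε i then y i else x i)
      ≤ signMean fun ε => 1 / 2 * prodMean w (fun x => Ψ ε x)
          + 1 / 2 * prodMean w (fun x => Ψ (fun i => !(ε i)) x) := by
    refine signMean_mono fun ε => ?_
    refine (prodMean_mono hw0 fun x => prodMean_mono hw0 fun y => hpt ε x y).trans (le_of_eq ?_)
    simp only [prodMean_add, prodMean_const_mul, prodMean_const hw]
  refine h1.trans (h2.trans_le (h3.trans (le_of_eq ?_)))
  have h4 := signMean_not fun ε => prodMean w (fun x => Ψ ε x)
  simp only [signMean] at h4 ⊢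
  rw [prodMean_add, prodMean_const_mul, prodMean_const_mul, h4, prodMean_comm]
  ring

end Symmetrization

/-! ### The uniform lower bound for the empirical quadratic form. -/

section EmpiricalProcess

variable {m₁ m₂ : ℕ} {ι : Type*} [Fintype ι] [DecidableEq ι]

/-- The weighted sum of the indicator matrices of the positions `x i`. -/
noncomputable def markedMatrix (x : ι → Fin m₁ × Fin m₂) (y : ι → ℝ) :
    Matrix (Fin m₁) (Fin m₂) ℝ :=
  ∑ i, y i • Matrix.single (x i).1 (x i).2 (1 : ℝ)

omit [DecidableEq ι] in
lemma sum_mul_entry_eq_traceInner (x : ι → Fin m₁ × Fin m₂) (y : ι → ℝ)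
    (A : Matrix (Fin m₁) (Fin m₂) ℝ) :
    ∑ i, y i * A (x i).1 (x i).2 = traceInner (markedMatrix x y) A := by
  rw [markedMatrix, traceInner, Matrix.transpose_sum, Matrix.sum_mul, Matrix.trace_sum]
  refine Finset.sum_congr rfl fun i _ => ?_
  rw [Matrix.transpose_smul, Matrix.smul_mul, Matrix.trace_smul, smul_eq_mul,
    ← traceInner_single (x i).1 (x i).2 A, traceInner]

-- Duality is applied to A and A₀ separately, so no triangle inequality for the nuclear norm is
-- needed.
omit [DecidableEq ι] in
lemma abs_sum_mul_sub_le (x : ι → Fin m₁ × Fin m₂) (y : ι → ℝ)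
    (A A₀ : Matrix (Fin m₁) (Fin m₂) ℝ) :
    |∑ i, y i * (A (x i).1 (x i).2 - A₀ (x i).1 (x i).2)|
      ≤ ‖markedMatrix x y‖ * (nuclearNorm A + nuclearNorm A₀) := by
  simp only [mul_sub, Finset.sum_sub_distrib, sum_mul_entry_eq_traceInner]
  rw [mul_add]
  exact (abs_sub _ _).trans (add_le_add (abs_traceInner_le _ _) (abs_traceInner_le _ _))

omit [DecidableEq ι] in
lemma norm_markedMatrix_pow_le (x : ι → Fin m₁ × Fin m₂) (y : ι → ℝ) (r : ℕ) :
    ‖markedMatrix x y‖ ^ (2 * 2 ^ r)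
      ≤ ((∑ i, y i • dilatedIndicator (x i)) ^ (2 * 2 ^ r)).trace := by
  rw [sum_smul_dilatedIndicator]
  exact norm_pow_le_trace_dilation_pow _ r

lemma signMean_prod_pow (m : ι → ℕ) :
    signMean (fun ε => ∏ i, boolSign (ε i) ^ m i) = ∏ i, ∑ b, 1 / 2 * boolSign b ^ m i := by
  rw [Finset.prod_univ_sum, Fintype.piFinset_univ, signMean, prodMean]
  exact Finset.sum_congr rfl fun ε _ => by rw [Finset.prod_mul_distrib]

/-- Moments of the operator norm of a Rademacher sum of random indicator matrices. -/
lemma prodMean_signMean_norm_pow_le {p : Fin m₁ → Fin m₂ → ℝ} (hp0 : ∀ k l, 0 ≤ p k l)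
    (hp : ∑ a : Fin m₁ × Fin m₂, p a.1 a.2 = 1) {L : ℝ} (hL : MarginalBound p L)
    (hρ : 0 < L / (min m₁ m₂ : ℕ)) {η : ℝ} (hη : 0 < η) (hη1 : η ≤ 1) (r : ℕ)
    (hn : 0 < Fintype.card ι)
    (hr : η * (2 ^ r : ℕ) ≤ Fintype.card ι * (L / (min m₁ m₂ : ℕ)) / 4) :
    prodMean (fun a : Fin m₁ × Fin m₂ => p a.1 a.2) (fun x : ι → Fin m₁ × Fin m₂ =>
        signMean fun ε => ‖markedMatrix x fun i => boolSign (ε i)‖ ^ (2 * 2 ^ r))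
      ≤ ((m₁ : ℝ) + m₂) * (4 * Real.exp 6 * (Fintype.card ι * (L / (min m₁ m₂ : ℕ))) *
          (2 ^ r : ℕ) / η) ^ (2 ^ r) := by
  have hw0 : ∀ a : Fin m₁ × Fin m₂, 0 ≤ p a.1 a.2 := fun a => hp0 _ _
  have h1 : prodMean (fun a : Fin m₁ × Fin m₂ => p a.1 a.2) (fun x : ι → Fin m₁ × Fin m₂ =>
        signMean fun ε => ‖markedMatrix x fun i => boolSign (ε i)‖ ^ (2 * 2 ^ r))
      ≤ prodMean (fun a : Fin m₁ × Fin m₂ => p a.1 a.2) (fun x : ι → Fin m₁ × Fin m₂ =>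
        signMean fun ε => ∑ f : Fin (2 * 2 ^ r) → ι,
          (wordProd dilatedIndicator f x).trace * ∏ i, boolSign (ε i) ^ letterCount f i) := by
    refine prodMean_mono hw0 fun x => signMean_mono fun ε => ?_
    refine (norm_markedMatrix_pow_le x _ r).trans (le_of_eq ?_)
    rw [trace_sum_smul_pow]
    exact Finset.sum_congr rfl fun f _ => mul_comm _ _
  refine h1.trans ?_
  have h2 : prodMean (fun a : Fin m₁ × Fin m₂ => p a.1 a.2) (fun x : ι → Fin m₁ × Fin m₂ =>
        signMean fun ε => ∑ f : Fin (2 * 2 ^ r) → ι,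
          (wordProd dilatedIndicator f x).trace * ∏ i, boolSign (ε i) ^ letterCount f i)
      = ∑ f : Fin (2 * 2 ^ r) → ι, (∏ i, ∑ b, 1 / 2 * boolSign b ^ letterCount f i) *
        prodMean (fun a : Fin m₁ × Fin m₂ => p a.1 a.2)
          fun x => (wordProd dilatedIndicator f x).trace := by
    simp only [← signMean_prod_pow]
    simp only [signMean, prodMean_sum, prodMean_const_mul]
    refine Finset.sum_congr rfl fun f _ => ?_
    rw [← prodMean_const_mul]
    simp only [mul_comm]
  rw [h2]
  have h3 := sum_word_gaussian_moments_le (ι := ι) (w := fun a : Fin m₁ × Fin m₂ => p a.1 a.2)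
    hw0 hp dilatedIndicator_nonneg sum_dilatedIndicator_le_one hρ
    (sum_mul_sum_dilatedIndicator_le hL) (M := fun _ k => ∑ b, 1 / 2 * boolSign b ^ k) (c := 1)
    one_pos (by intro i; simp) (by intro i; simp [boolSign]) ?_ hη hη1
    (p := 2 ^ r) (by positivity) hn hr
  · simpa using h3
  · intro i j
    have hj : (1 : ℝ) ≤ j.factorial := by exact_mod_cast j.factorial_pos
    have he : (1 : ℝ) ≤ Real.exp 1 := Real.one_le_exp (by norm_num)
    calc |∑ b, 1 / 2 * boolSign b ^ j| ≤ ∑ b, |1 / 2 * boolSign b ^ j| :=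
          Finset.abs_sum_le_sum_abs _ _
      _ = 1 := by simp [abs_mul, abs_pow, abs_boolSign]
      _ ≤ Real.exp 1 * 1 ^ j * j.factorial := by rw [one_pow]; nlinarith

/-- Where R exceeds T, the ratio R/T is at least 1 and hence at most its q-th power. This converts a
high moment of R into a bound for its mean excess over T. -/
lemma max_sub_zero_le_mul_pow {R T : ℝ} (hR : 0 ≤ R) (hT : 0 < T) {q : ℕ} (hq : q ≠ 0) :
    max (R - T) 0 ≤ T / T ^ q * R ^ q := by
  rw [div_mul_eq_mul_div, mul_div_assoc, ← div_pow]
  refine max_le ?_ (by positivity)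
  by_cases h : R ≤ T
  · exact (sub_nonpos.2 h).trans (by positivity)
  · have h1 : 1 ≤ R / T := by rw [le_div_iff₀ hT]; linarith
    have h2 := mul_le_mul_of_nonneg_left (le_self_pow₀ h1 hq) hT.le
    rw [mul_div_cancel₀ _ hT.ne'] at h2
    linarith

open Classical in
/-- The weight of the samples for which some matrix in the entry ball violates the penalised
lower bound for the empirical quadratic form. -/
lemma prodMean_violation_le {p : Fin m₁ → Fin m₂ → ℝ} (hp0 : ∀ k l, 0 ≤ p k l)
    (hp : ∑ a : Fin m₁ × Fin m₂, p a.1 a.2 = 1) {ζ : ℝ} (hζ : 0 ≤ ζ)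
    {A₀ : Matrix (Fin m₁) (Fin m₂) ℝ} (hA₀ : A₀ ∈ entryBall m₁ m₂ ζ) {T τ : ℝ}
    (S : Set (ι → Fin m₁ × Fin m₂))
    (hS : ∀ x ∈ S, ∃ A ∈ entryBall m₁ m₂ ζ, τ < ∑ i,
        ((∑ a : Fin m₁ × Fin m₂, p a.1 a.2 * (A a.1 a.2 - A₀ a.1 a.2) ^ 2)
          - (A (x i).1 (x i).2 - A₀ (x i).1 (x i).2) ^ 2)
        - 8 * ζ * T * (nuclearNorm A + nuclearNorm A₀)) :
    prodMean (fun a : Fin m₁ × Fin m₂ => p a.1 a.2) (fun x => if x ∈ S then 1 else 0) * τ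
      ≤ 8 * ζ * (2 * (m₂ * (ζ * Real.sqrt (m₁ * m₂)))) *
        prodMean (fun a : Fin m₁ × Fin m₂ => p a.1 a.2) fun x : ι → Fin m₁ × Fin m₂ =>
          signMean fun ε => max (‖markedMatrix x fun i => boolSign (ε i)‖ - T) 0 := by
  have hw0 : ∀ a : Fin m₁ × Fin m₂, 0 ≤ p a.1 a.2 := fun a => hp0 _ _
  -- One violating matrix is selected for each sample. There are finitely many samples, so the
  -- supremum over the ball is replaced by one over a finite family.
  have hsel : ∀ x, ∃ A ∈ entryBall m₁ m₂ ζ, x ∈ S → τ < ∑ i,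
        ((∑ a : Fin m₁ × Fin m₂, p a.1 a.2 * (A a.1 a.2 - A₀ a.1 a.2) ^ 2)
          - (A (x i).1 (x i).2 - A₀ (x i).1 (x i).2) ^ 2)
        - 8 * ζ * T * (nuclearNorm A + nuclearNorm A₀) := by
    intro x
    by_cases hx : x ∈ S
    · obtain ⟨A, hA, h⟩ := hS x hx
      exact ⟨A, hA, fun _ => h⟩
    · exact ⟨A₀, hA₀, fun h => absurd h hx⟩
  choose A hA hAτ using hsel
  -- The zero function is adjoined so that the supremum is nonnegative.
  let D : Option (ι → Fin m₁ × Fin m₂) → Fin m₁ × Fin m₂ → ℝ := fun t a =>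
    t.elim 0 fun v => A v a.1 a.2 - A₀ a.1 a.2
  let f : Option (ι → Fin m₁ × Fin m₂) → ℝ := fun t =>
    t.elim 0 fun v => -(8 * ζ * T * (nuclearNorm (A v) + nuclearNorm A₀))
  have hD : ∀ t a, |D t a| ≤ 2 * ζ := by
    rintro (_ | v) a
    · simp [D, hζ]
    · have h1 := hA v a.1 a.2
      have h2 := hA₀ a.1 a.2
      simp only [D, Option.elim]
      have := abs_sub (A v a.1 a.2) (A₀ a.1 a.2)
      linarith
  have hle : ∀ (x : ι → Fin m₁ × Fin m₂) t,
      f t + ∑ i, ((∑ a, p a.1 a.2 * D t a ^ 2) - D t (x i) ^ 2)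
        ≤ ⨆ t, (f t + ∑ i, ((∑ a, p a.1 a.2 * D t a ^ 2) - D t (x i) ^ 2)) := fun x t =>
    le_ciSup (f := fun t => f t + ∑ i, ((∑ a, p a.1 a.2 * D t a ^ 2) - D t (x i) ^ 2))
      (Set.finite_range _).bddAbove t
  have h1 : prodMean (fun a : Fin m₁ × Fin m₂ => p a.1 a.2)
        (fun x => if x ∈ S then 1 else 0) * τ
      ≤ prodMean (fun a : Fin m₁ × Fin m₂ => p a.1 a.2) fun x : ι → Fin m₁ × Fin m₂ =>
        ⨆ t, (f t + ∑ i, ((∑ a, p a.1 a.2 * D t a ^ 2) - D t (x i) ^ 2)) := by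
    rw [mul_comm, ← prodMean_const_mul]
    refine prodMean_mono hw0 fun x => ?_
    by_cases hx : x ∈ S
    · rw [if_pos hx, mul_one]
      refine le_trans ?_ (hle x (some x))
      have := hAτ x hx
      simp only [f, D, Option.elim]
      linarith
    · rw [if_neg hx, mul_zero]
      refine le_trans ?_ (hle x none)
      simp [f, D]
  refine h1.trans ((prodMean_iSup_le_signMean hw0 hp f fun t a => D t a ^ 2).trans ?_)
  rw [← prodMean_const_mul]
  refine prodMean_mono hw0 fun x => ?_
  -- Squaring is Lipschitz on the relevant range: differences are at most 2ζ, so |D s + D t| ≤ 4ζ.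
  -- With the factor 2 from symmetrisation this gives the 8ζ.
  have hcontr : ∀ (i : ι) s t,
      |2 * D s (x i) ^ 2 - 2 * D t (x i) ^ 2| ≤ |8 * ζ * D s (x i) - 8 * ζ * D t (x i)| := by
    intro i s t
    have e1 : 2 * D s (x i) ^ 2 - 2 * D t (x i) ^ 2
        = 2 * (D s (x i) + D t (x i)) * (D s (x i) - D t (x i)) := by ring
    have e2 : 8 * ζ * D s (x i) - 8 * ζ * D t (x i) = 8 * ζ * (D s (x i) - D t (x i)) := by ring
    rw [e1, e2, abs_mul, abs_mul (8 * ζ), abs_of_nonneg (by positivity : 0 ≤ 8 * ζ), abs_mul,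
      abs_two]
    refine mul_le_mul_of_nonneg_right ?_ (abs_nonneg _)
    have := abs_add_le (D s (x i)) (D t (x i))
    have := hD s (x i)
    have := hD t (x i)
    linarith
  refine (signMean_iSup_le_of_contraction f (a := fun i t => 2 * D t (x i) ^ 2)
    (b := fun i t => 8 * ζ * D t (x i)) hcontr).trans ?_
  rw [signMean, signMean, ← prodMean_const_mul]
  refine prodMean_mono (fun _ => by norm_num) fun ε => ?_
  refine ciSup_le fun t => ?_
  set R := ‖markedMatrix x fun i => boolSign (ε i)‖ with hR
  have hmax : 0 ≤ max (R - T) 0 := le_max_right _ _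
  rcases t with _ | v
  · have : 0 ≤ 8 * ζ * (2 * (m₂ * (ζ * Real.sqrt (m₁ * m₂)))) * max (R - T) 0 := by positivity
    simpa [f, D] using this
  · simp only [f, D, Option.elim]
    have e1 : ∑ i, boolSign (ε i) * (8 * ζ * (A v (x i).1 (x i).2 - A₀ (x i).1 (x i).2))
        = 8 * ζ * ∑ i, boolSign (ε i) * (A v (x i).1 (x i).2 - A₀ (x i).1 (x i).2) := by
      rw [Finset.mul_sum]; exact Finset.sum_congr rfl fun i _ => by ring
    rw [e1]
    have h2 := (le_abs_self _).trans (abs_sum_mul_sub_le x (fun i => boolSign (ε i)) (A v) A₀)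
    have h3 := nuclearNorm_le_of_mem_entryBall hζ (hA v)
    have h4 := nuclearNorm_le_of_mem_entryBall hζ hA₀
    have h5 : 0 ≤ nuclearNorm (A v) + nuclearNorm A₀ :=
      add_nonneg (nuclearNorm_nonneg _) (nuclearNorm_nonneg _)
    -- The penalty compensates the operator norm R up to the level T. Only the excess R - T is
    -- multiplied by the crude nuclear norm bound over the entry ball.
    calc -(8 * ζ * T * (nuclearNorm (A v) + nuclearNorm A₀)) + 8 * ζ *
          ∑ i, boolSign (ε i) * (A v (x i).1 (x i).2 - A₀ (x i).1 (x i).2)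
        ≤ -(8 * ζ * T * (nuclearNorm (A v) + nuclearNorm A₀)) + 8 * ζ *
          (R * (nuclearNorm (A v) + nuclearNorm A₀)) := by gcongr
      _ = 8 * ζ * ((nuclearNorm (A v) + nuclearNorm A₀) * (R - T)) := by ring
      _ ≤ 8 * ζ * ((2 * (m₂ * (ζ * Real.sqrt (m₁ * m₂)))) * max (R - T) 0) := by
          refine mul_le_mul_of_nonneg_left ?_ (by positivity)
          refine (mul_le_mul_of_nonneg_left (le_max_left _ 0) h5).trans ?_
          refine mul_le_mul_of_nonneg_right ?_ hmax
          linarith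
      _ = _ := by ring

end EmpiricalProcess

/-! ### The moment order and the numerical constants. -/

section Constants

variable {m₁ m₂ n : ℕ}

lemma two_le_dimSum (h₁ : 0 < m₁) (h₂ : 0 < m₂) : 2 ≤ dimSum m₁ m₂ := by
  have h1 : (1 : ℝ) ≤ m₁ := by exact_mod_cast h₁
  have h2 : (1 : ℝ) ≤ m₂ := by exact_mod_cast h₂
  rw [dimSum]; linarith

lemma exists_two_pow_between {y : ℝ} (hy : 1 / 4 ≤ y) :
    ∃ r : ℕ, y ≤ (2 ^ r : ℕ) ∧ ((2 ^ r : ℕ) : ℝ) ≤ 4 * y := by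
  by_cases h : y ≤ 1
  · exact ⟨0, by simpa using h, by simp; linarith⟩
  · obtain ⟨k, hk1, hk2⟩ := exists_nat_pow_near (not_le.1 h).le (one_lt_two (α := ℝ))
    refine ⟨k + 1, by exact_mod_cast hk2.le, ?_⟩
    push_cast
    rw [pow_succ]
    linarith

/-- The ratio between the operator norm bound and `n` times the rate. -/
noncomputable def deviationConst (b : ℝ) : ℝ := 4 * Real.exp 5 / Real.sqrt (min 1 (b / 8))

lemma deviationConst_pos {b : ℝ} (hb : 0 < b) : 0 < deviationConst b := by
  have : 0 < min 1 (b / 8) := lt_min one_pos (by positivity)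
  rw [deviationConst]
  have := Real.sqrt_pos.2 this
  positivity

/-- The high-probability bound for the operator norm of a Rademacher sum of `n` indicators. -/
noncomputable def normBound (m₁ m₂ n : ℕ) (L b : ℝ) : ℝ :=
  deviationConst b * (n * (mainRate m₁ m₂ n L / Real.sqrt (m₁ * m₂)))

lemma normBound_sq {L b : ℝ} (hb : 0 < b) (hL : 1 ≤ L) (h₁ : 0 < m₁) (h₂ : 0 < m₂) (hn : 0 < n) :
    normBound m₁ m₂ n L b ^ 2 = 16 * Real.exp 10 / min 1 (b / 8) *
      (n * (L * dimSum m₁ m₂ * Real.log (dimSum m₁ m₂)) / (m₁ * m₂)) := by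
  have hη : 0 < min 1 (b / 8) := lt_min one_pos (by positivity)
  have hd := two_le_dimSum h₁ h₂
  have hlog : 0 < Real.log (dimSum m₁ m₂) := Real.log_pos (by linarith)
  have h1 : (0 : ℝ) < m₁ := by exact_mod_cast h₁
  have h2 : (0 : ℝ) < m₂ := by exact_mod_cast h₂
  have hn' : (0 : ℝ) < n := by exact_mod_cast hn
  have he : Real.exp 5 ^ 2 = Real.exp 10 := by rw [← Real.exp_nat_mul]; norm_num
  rw [normBound, deviationConst, mainRate, mul_pow, mul_pow, div_pow, div_pow, mul_pow, he,
    Real.sq_sqrt hη.le, Real.sq_sqrt (by positivity), Real.sq_sqrt (by positivity)]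
  field_simp
  norm_num

lemma inv_min_le (h₁ : 0 < m₁) (h₂ : 0 < m₂) :
    1 / ((min m₁ m₂ : ℕ) : ℝ) ≤ dimSum m₁ m₂ / (m₁ * m₂) := by
  have h1 : (0 : ℝ) < m₁ := by exact_mod_cast h₁
  have h2 : (0 : ℝ) < m₂ := by exact_mod_cast h₂
  rw [dimSum]
  rcases min_choice m₁ m₂ with h | h <;> rw [h, div_le_div_iff₀ (by positivity) (by positivity)] <;>
    nlinarith

lemma two_mul_min_le_dimSum : 2 * ((min m₁ m₂ : ℕ) : ℝ) ≤ dimSum m₁ m₂ := by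
  have h1 : ((min m₁ m₂ : ℕ) : ℝ) ≤ m₁ := by exact_mod_cast min_le_left _ _
  have h2 : ((min m₁ m₂ : ℕ) : ℝ) ≤ m₂ := by exact_mod_cast min_le_right _ _
  rw [dimSum]; linarith

/-- A power of two `2 ^ r`, comparable to `log d`, for which the trace moment bounds apply. -/
lemma exists_moment_order {L b : ℝ} (hb : 0 < b) (hL : 1 ≤ L) (h₁ : 0 < m₁) (h₂ : 0 < m₂)
    (hn : b * (dimSum m₁ m₂ * Real.log (dimSum m₁ m₂)) ≤ n) (hn0 : 0 < n) :
    ∃ r : ℕ, Real.log (dimSum m₁ m₂) ≤ (2 ^ r : ℕ) ∧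
      min 1 (b / 8) * (2 ^ r : ℕ) ≤ n * (L / (min m₁ m₂ : ℕ)) / 4 ∧
      Real.exp 4 * (4 * Real.exp 6 * (n * (L / (min m₁ m₂ : ℕ))) * (2 ^ r : ℕ) / min 1 (b / 8))
        ≤ normBound m₁ m₂ n L b ^ 2 := by
  have hd := two_le_dimSum h₁ h₂
  have hlog2 : 1 / 4 ≤ Real.log (dimSum m₁ m₂) := by
    have := Real.log_two_gt_d9
    have := Real.log_le_log two_pos hd
    linarith
  have hn' : (0 : ℝ) < n := by exact_mod_cast hn0
  have hη : 0 < min 1 (b / 8) := lt_min one_pos (by positivity)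
  have hm : (0 : ℝ) < (min m₁ m₂ : ℕ) := by exact_mod_cast lt_min h₁ h₂
  obtain ⟨r, hr1, hr2⟩ := exists_two_pow_between hlog2
  refine ⟨r, hr1, ?_, ?_⟩
  · have h3 : 2 * b * Real.log (dimSum m₁ m₂) ≤ n * (L / (min m₁ m₂ : ℕ)) := by
      rw [← mul_div_assoc, le_div_iff₀ hm]
      have h4 := two_mul_min_le_dimSum (m₁ := m₁) (m₂ := m₂)
      calc 2 * b * Real.log (dimSum m₁ m₂) * (min m₁ m₂ : ℕ)
          = b * ((2 * ((min m₁ m₂ : ℕ) : ℝ)) * Real.log (dimSum m₁ m₂)) := by ring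
        _ ≤ b * (dimSum m₁ m₂ * Real.log (dimSum m₁ m₂)) := by gcongr
        _ ≤ n := hn
        _ ≤ n * L := le_mul_of_one_le_right hn'.le hL
    calc min 1 (b / 8) * (2 ^ r : ℕ) ≤ b / 8 * (4 * Real.log (dimSum m₁ m₂)) :=
          mul_le_mul (min_le_right _ _) hr2 (by positivity) (by positivity)
      _ = 2 * b * Real.log (dimSum m₁ m₂) / 4 := by ring
      _ ≤ _ := by gcongr
  · rw [normBound_sq hb hL h₁ h₂ hn0]
    have he : Real.exp 10 = Real.exp 4 * Real.exp 6 := by rw [← Real.exp_add]; norm_num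
    have h5 := inv_min_le h₁ h₂
    -- The constant 16e¹⁰ is composed of 4e⁶ from the trace bound, 4 from rounding log d up to a
    -- power of two, and a margin e⁴ that will yield powers of 1/d.
    calc Real.exp 4 * (4 * Real.exp 6 * (n * (L / (min m₁ m₂ : ℕ))) * (2 ^ r : ℕ) / min 1 (b / 8))
        = 4 * Real.exp 10 / min 1 (b / 8) *
            (n * L * ((2 ^ r : ℕ) * (1 / ((min m₁ m₂ : ℕ) : ℝ)))) := by rw [he]; ring
      _ ≤ 4 * Real.exp 10 / min 1 (b / 8) *
            (n * L * ((4 * Real.log (dimSum m₁ m₂)) * (dimSum m₁ m₂ / (m₁ * m₂)))) := by gcongr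
      _ = _ := by ring

end Constants

/-! ### Probabilities of the two bad events. -/

section Events

variable {m₁ m₂ n : ℕ} {Ω : Type*} [MeasurableSpace Ω] {μ : Measure Ω} [IsProbabilityMeasure μ]

/-- The penalised lower bound for the empirical quadratic form fails for some matrix. -/
def violationSet (n : ℕ) (p : Fin m₁ → Fin m₂ → ℝ) (A₀ : Matrix (Fin m₁) (Fin m₂) ℝ)
    (ζ T τ : ℝ) : Set (Fin n → Fin m₁ × Fin m₂) :=
  {x | ∃ A ∈ entryBall m₁ m₂ ζ, τ < ∑ i,
        ((∑ a : Fin m₁ × Fin m₂, p a.1 a.2 * (A a.1 a.2 - A₀ a.1 a.2) ^ 2)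
          - (A (x i).1 (x i).2 - A₀ (x i).1 (x i).2) ^ 2)
        - 8 * ζ * T * (nuclearNorm A + nuclearNorm A₀)}

-- The argument is Markov's inequality for the expected supremum. The nuclear norm bound over the
-- ball is only polynomial in the dimensions, but the mean excess of the Rademacher norm over T is
-- at most T/d³, which outweighs it.
open Classical in
lemma prodMean_violationSet_le {p : Fin m₁ → Fin m₂ → ℝ} (hp0 : ∀ k l, 0 ≤ p k l)
    (hp : ∑ a : Fin m₁ × Fin m₂, p a.1 a.2 = 1) {L b ζ : ℝ} (hL : MarginalBound p L)
    (hL1 : 1 ≤ L) (hb : 0 < b) (h₁ : 0 < m₁) (h₂ : 0 < m₂)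
    (hn : b * (dimSum m₁ m₂ * Real.log (dimSum m₁ m₂)) ≤ n) (hn0 : 0 < n) (hζ : 0 ≤ ζ)
    {A₀ : Matrix (Fin m₁) (Fin m₂) ℝ} (hA₀ : A₀ ∈ entryBall m₁ m₂ ζ) :
    prodMean (fun a : Fin m₁ × Fin m₂ => p a.1 a.2) (fun x =>
      if x ∈ violationSet n p A₀ ζ (normBound m₁ m₂ n L b)
        (n * (16 * deviationConst b * ζ ^ 2 * Real.sqrt (L * Real.log (dimSum m₁ m₂) / n)))
      then 1 else 0) ≤ 1 / dimSum m₁ m₂ := by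
  have hd := two_le_dimSum h₁ h₂
  have hd0 : 0 < dimSum m₁ m₂ := by linarith
  have hlog : 0 < Real.log (dimSum m₁ m₂) := Real.log_pos (by linarith)
  have h1 : (0 : ℝ) < m₁ := by exact_mod_cast h₁
  have h2 : (0 : ℝ) < m₂ := by exact_mod_cast h₂
  have hn' : (0 : ℝ) < n := by exact_mod_cast hn0
  have hH := deviationConst_pos hb
  set d := dimSum m₁ m₂ with hdef
  set H := deviationConst b with hHdef
  set T := normBound m₁ m₂ n L b with hTdef
  set u := Real.sqrt (L * Real.log d / n) with hu
  have hu0 : 0 < u := Real.sqrt_pos.2 (by positivity)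
  have hw0 : ∀ a : Fin m₁ × Fin m₂, 0 ≤ p a.1 a.2 := fun a => hp0 _ _
  -- For ζ = 0 the threshold vanishes and cannot be divided out at the end. Then both matrices are
  -- zero and no violation occurs.
  rcases hζ.eq_or_lt with hz | hζ0
  · have hempty : violationSet n p A₀ ζ T (n * (16 * H * ζ ^ 2 * u)) = ∅ := by
      refine Set.eq_empty_of_forall_notMem ?_
      rintro x ⟨A, hA, h⟩
      have e1 : ∀ k l, A k l = 0 := fun k l =>
        abs_nonpos_iff.1 ((hA k l).trans hz.symm.le)
      have e2 : ∀ k l, A₀ k l = 0 := fun k l =>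
        abs_nonpos_iff.1 ((hA₀ k l).trans hz.symm.le)
      simp [e1, e2, ← hz] at h
    rw [hempty]
    simp only [Set.mem_empty_iff_false, if_false]
    rw [prodMean_const hp]
    positivity
  obtain ⟨r, hr1, hr2, hr3⟩ := exists_moment_order hb hL1 h₁ h₂ hn hn0
  set η := min 1 (b / 8) with hη
  have hη0 : 0 < η := lt_min one_pos (by positivity)
  set V := 4 * Real.exp 6 * (n * (L / (min m₁ m₂ : ℕ))) * (2 ^ r : ℕ) / η with hV
  have hm : (0 : ℝ) < (min m₁ m₂ : ℕ) := by exact_mod_cast lt_min h₁ h₂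
  have hV0 : 0 ≤ V := by positivity
  have hrate : mainRate m₁ m₂ n L = Real.sqrt d * u := by
    rw [mainRate, hu, ← Real.sqrt_mul hd0.le]
    congr 1
    ring
  have hN0 : 0 < Real.sqrt ((m₁ : ℝ) * m₂) := Real.sqrt_pos.2 (by positivity)
  have hTN : Real.sqrt ((m₁ : ℝ) * m₂) * T = H * (n * (Real.sqrt d * u)) := by
    rw [hTdef, normBound, hrate, ← hHdef]; field_simp
  have hT0 : 0 < T := by
    rw [hTdef, normBound, hrate]
    have := Real.sqrt_pos.2 hd0
    positivity
  have hmom := prodMean_signMean_norm_pow_le (ι := Fin n) hp0 hp hL (by positivity) hη0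
    (min_le_left _ _) r (by simpa using hn0) (by simpa using hr2)
  rw [Fintype.card_fin, ← hV] at hmom
  have hdev : prodMean (fun a : Fin m₁ × Fin m₂ => p a.1 a.2) (fun x : Fin n → Fin m₁ × Fin m₂ =>
      signMean fun ε => max (‖markedMatrix x fun i => boolSign (ε i)‖ - T) 0) ≤ T * (1 / d ^ 3) := by
    calc _ ≤ prodMean (fun a : Fin m₁ × Fin m₂ => p a.1 a.2) (fun x : Fin n → Fin m₁ × Fin m₂ =>
          signMean fun ε => T / T ^ (2 * 2 ^ r) *
            ‖markedMatrix x fun i => boolSign (ε i)‖ ^ (2 * 2 ^ r)) :=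
          prodMean_mono hw0 fun x => signMean_mono fun ε =>
            max_sub_zero_le_mul_pow (norm_nonneg _) hT0 (by positivity)
      _ ≤ T / T ^ (2 * 2 ^ r) * (d * V ^ 2 ^ r) := by
          simp only [signMean, prodMean_const_mul] at hmom ⊢
          exact mul_le_mul_of_nonneg_left hmom (by positivity)
      _ ≤ T / T ^ (2 * 2 ^ r) * (d * (T ^ (2 * 2 ^ r) * (1 / d ^ 4))) := by
          refine mul_le_mul_of_nonneg_left (mul_le_mul_of_nonneg_left ?_ hd0.le) (by positivity)
          -- As 2^r ≥ log d, the margin e⁴ raised to the power 2^r is at least d⁴. One factor d is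
          -- lost to the dimension in the trace, which leaves 1/d³.
          have h3 : d ^ 4 ≤ Real.exp 4 ^ 2 ^ r := by
            rw [← Real.exp_nat_mul, ← Real.exp_log hd0, ← Real.exp_nat_mul]
            refine Real.exp_le_exp.2 ?_
            push_cast at hr1 ⊢
            linarith
          rw [mul_one_div, le_div_iff₀ (by positivity)]
          calc V ^ 2 ^ r * d ^ 4 ≤ V ^ 2 ^ r * Real.exp 4 ^ 2 ^ r := by gcongr
            _ = (Real.exp 4 * V) ^ 2 ^ r := by rw [mul_pow]; ring
            _ ≤ (T ^ 2) ^ 2 ^ r := pow_le_pow_left₀ (by positivity) hr3 _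
            _ = T ^ (2 * 2 ^ r) := by rw [pow_mul]
      _ = T * (1 / d ^ 3) := by field_simp
  have hmain := prodMean_violation_le (T := T) (τ := n * (16 * H * ζ ^ 2 * u)) hp0 hp hζ hA₀
    (violationSet n p A₀ ζ T (n * (16 * H * ζ ^ 2 * u))) fun x hx => hx
  set P := prodMean (fun a : Fin m₁ × Fin m₂ => p a.1 a.2) (fun x =>
    if x ∈ violationSet n p A₀ ζ T (n * (16 * H * ζ ^ 2 * u)) then 1 else 0) with hP
  have h4 : P * (n * (16 * H * ζ ^ 2 * u)) ≤ 1 / d * (n * (16 * H * ζ ^ 2 * u)) := by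
    have hsd : Real.sqrt d ≤ d := by
      rw [Real.sqrt_le_left hd0.le]; nlinarith
    have hmd : (m₂ : ℝ) ≤ d := by rw [hdef, dimSum]; linarith
    calc P * (n * (16 * H * ζ ^ 2 * u))
        ≤ 8 * ζ * (2 * (m₂ * (ζ * Real.sqrt (m₁ * m₂)))) * (T * (1 / d ^ 3)) :=
          hmain.trans (mul_le_mul_of_nonneg_left hdev (by positivity))
      _ = 16 * ζ ^ 2 * m₂ * (Real.sqrt ((m₁ : ℝ) * m₂) * T) * (1 / d ^ 3) := by ring
      _ = 16 * ζ ^ 2 * H * n * u * (m₂ * Real.sqrt d * (1 / d ^ 3)) := by rw [hTN]; ring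
      _ ≤ 16 * ζ ^ 2 * H * n * u * (d * d * (1 / d ^ 3)) := by gcongr
      _ = 1 / d * (n * (16 * H * ζ ^ 2 * u)) := by field_simp
  exact le_of_mul_le_mul_right h4 (by positivity)

/-- The operator norm of the noise term exceeds its typical size with small probability. -/
lemma measureReal_lt_norm_markedMatrix_le {p : Fin m₁ → Fin m₂ → ℝ}
    {x : Fin n → Ω → Fin m₁ × Fin m₂} {ξ : Fin n → Ω → ℝ} {c L b : ℝ} (hc : 0 < c)
    (hs : IsMarkedSample μ (fun a => p a.1 a.2) x ξ) (hmean : ∀ i, ∫ ω, ξ i ω ∂μ = 0)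
    (hξm : ∀ i k, |∫ ω, ξ i ω ^ k ∂μ| ≤ Real.exp 1 * c ^ k * k.factorial)
    (hL : MarginalBound p L) (hL1 : 1 ≤ L) (hb : 0 < b) (h₁ : 0 < m₁) (h₂ : 0 < m₂)
    (hn : b * (dimSum m₁ m₂ * Real.log (dimSum m₁ m₂)) ≤ n) (hn0 : 0 < n) :
    μ.real {ω | c * normBound m₁ m₂ n L b < ‖markedMatrix (fun i => x i ω) fun i => ξ i ω‖}
      ≤ 1 / dimSum m₁ m₂ := by
  have hd := two_le_dimSum h₁ h₂
  have hd0 : 0 < dimSum m₁ m₂ := by linarith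
  have hlog : 0 < Real.log (dimSum m₁ m₂) := Real.log_pos (by linarith)
  have hn' : (0 : ℝ) < n := by exact_mod_cast hn0
  have hm : (0 : ℝ) < (min m₁ m₂ : ℕ) := by exact_mod_cast lt_min h₁ h₂
  obtain ⟨r, hr1, hr2, hr3⟩ := exists_moment_order hb hL1 h₁ h₂ hn hn0
  set d := dimSum m₁ m₂ with hdef
  set T := normBound m₁ m₂ n L b with hTdef
  set η := min 1 (b / 8) with hη
  have hη0 : 0 < η := lt_min one_pos (by positivity)
  set V := 4 * Real.exp 6 * (n * (L / (min m₁ m₂ : ℕ))) * (2 ^ r : ℕ) / η with hV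
  have hV0 : 0 < V := by positivity
  have hT0 : 0 ≤ T := by
    have := deviationConst_pos hb
    rw [hTdef, normBound, mainRate]; positivity
  have hw0 := hs.weight_nonneg ⟨0, hn0⟩
  have hw := hs.sum_weight ⟨0, hn0⟩
  have hint := hs.integrable_trace_pow dilatedIndicator (2 * 2 ^ r)
  have hmom := sum_word_gaussian_moments_le (ι := Fin n) hw0 hw dilatedIndicator_nonneg
    sum_dilatedIndicator_le_one (by positivity) (sum_mul_sum_dilatedIndicator_le hL)
    (M := fun i k => ∫ ω, ξ i ω ^ k ∂μ) hc (by simp) (by simpa using hmean) hξm hη0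
    (min_le_left _ _) (p := 2 ^ r) (by positivity) (by simpa using hn0) (by simpa using hr2)
  rw [← hs.integral_trace_pow dilatedIndicator (2 * 2 ^ r), Fintype.card_fin] at hmom
  have hcV : 4 * Real.exp 6 * c ^ 2 * (n * (L / (min m₁ m₂ : ℕ))) * (2 ^ r : ℕ) / η = c ^ 2 * V := by
    rw [hV]; ring
  have hcard : (Fintype.card (Fin m₁ ⊕ Fin m₂) : ℝ) = d := by simp [hdef, dimSum]
  rw [hcV, hcard] at hmom
  have hnorm : ∀ ω, ‖markedMatrix (fun i => x i ω) fun i => ξ i ω‖ ^ (2 * 2 ^ r)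
      ≤ ((∑ i, ξ i ω • dilatedIndicator (x i ω)) ^ (2 * 2 ^ r)).trace := fun ω =>
    norm_markedMatrix_pow_le (fun i => x i ω) (fun i => ξ i ω) r
  -- A margin of e² suffices here: Markov's inequality at level Θ gives d · e^(-2·2^r) ≤ d · d⁻² =
  -- 1/d.
  set Θ := (Real.exp 2 * (c ^ 2 * V)) ^ 2 ^ r with hΘ
  have hΘ0 : 0 < Θ := by positivity
  have hmarkov := mul_meas_ge_le_integral_of_nonneg (μ := μ)
    (Filter.Eventually.of_forall fun ω => le_trans (by positivity) (hnorm ω)) hint Θ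
  have hsub : {ω | c * T < ‖markedMatrix (fun i => x i ω) fun i => ξ i ω‖} ⊆
      {ω | Θ ≤ ((∑ i, ξ i ω • dilatedIndicator (x i ω)) ^ (2 * 2 ^ r)).trace} := by
    intro ω hω
    refine le_trans ?_ (hnorm ω)
    rw [hΘ, pow_mul]
    refine pow_le_pow_left₀ (by positivity) ?_ _
    have h1 : Real.exp 2 * V ≤ T ^ 2 :=
      (mul_le_mul_of_nonneg_right (Real.exp_le_exp.2 (by norm_num)) hV0.le).trans hr3
    calc Real.exp 2 * (c ^ 2 * V) = c ^ 2 * (Real.exp 2 * V) := by ring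
      _ ≤ c ^ 2 * T ^ 2 := by gcongr
      _ = (c * T) ^ 2 := by ring
      _ ≤ _ := pow_le_pow_left₀ (by positivity) (le_of_lt hω) 2
  have h2 : Θ * μ.real {ω | c * T < ‖markedMatrix (fun i => x i ω) fun i => ξ i ω‖}
      ≤ Θ * (1 / d) := by
    calc _ ≤ Θ * μ.real {ω | Θ ≤ ((∑ i, ξ i ω • dilatedIndicator (x i ω)) ^ (2 * 2 ^ r)).trace} :=
          mul_le_mul_of_nonneg_left (measureReal_mono hsub) hΘ0.le
      _ ≤ d * (c ^ 2 * V) ^ 2 ^ r := hmarkov.trans hmom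
      _ = d * (c ^ 2 * V) ^ 2 ^ r * d ^ 2 / d ^ 2 := by field_simp
      _ ≤ d * (c ^ 2 * V) ^ 2 ^ r * Real.exp 2 ^ 2 ^ r / d ^ 2 := by
          have h3 : d ^ 2 ≤ Real.exp 2 ^ 2 ^ r := by
            rw [← Real.exp_nat_mul, ← Real.exp_log hd0, ← Real.exp_nat_mul]
            refine Real.exp_le_exp.2 ?_
            push_cast at hr1 ⊢
            linarith
          gcongr
      _ = Θ * (1 / d) := by
          rw [hΘ, mul_pow (Real.exp 2)]
          generalize (c ^ 2 * V) ^ 2 ^ r = X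
          generalize Real.exp 2 ^ 2 ^ r = Y
          field_simp
  exact le_of_mul_le_mul_left h2 hΘ0

end Events

/-! ### The deterministic oracle inequality. -/

section Oracle

variable {m₁ m₂ n : ℕ}

lemma observation_sub {A₀ A : Matrix (Fin m₁) (Fin m₂) ℝ} {σ : ℝ}
    {T : Fin n → Matrix (Fin m₁) (Fin m₂) ℝ} {ξ : Fin n → ℝ} {x : Fin n → Fin m₁ × Fin m₂}
    (hT : ∀ i, T i = Matrix.single (x i).1 (x i).2 1) (i : Fin n) :
    observation A₀ σ T ξ i - traceInner (T i) A
      = σ * ξ i - (A (x i).1 (x i).2 - A₀ (x i).1 (x i).2) := by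
  rw [observation, hT i, traceInner_single, traceInner_single]
  ring

/-- The basic inequality for penalised least squares. -/
lemma IsTL1Estimator.basic_inequality {A₀ A : Matrix (Fin m₁) (Fin m₂) ℝ} {σ lam a ζ : ℝ}
    {T : Fin n → Matrix (Fin m₁) (Fin m₂) ℝ} {ξ : Fin n → ℝ} {x : Fin n → Fin m₁ × Fin m₂}
    (hT : ∀ i, T i = Matrix.single (x i).1 (x i).2 1) (hσ : 0 ≤ σ) (hn : 0 < n)
    (hA₀ : A₀ ∈ entryBall m₁ m₂ ζ)
    (h : IsTL1Estimator T (observation A₀ σ T ξ) lam a ζ A) :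
    ∑ i, (A (x i).1 (x i).2 - A₀ (x i).1 (x i).2) ^ 2
      ≤ 2 * σ * (‖markedMatrix x ξ‖ * (nuclearNorm A + nuclearNorm A₀))
        + n * (lam * TL1 a A₀ - lam * TL1 a A) := by
  have hn' : (0 : ℝ) < n := by exact_mod_cast hn
  have hmin : objective T (observation A₀ σ T ξ) lam a A
      ≤ objective T (observation A₀ σ T ξ) lam a A₀ := h.2 hA₀
  simp only [objective, observation_sub hT, sub_self, sub_zero] at hmin
  have hexp : ∑ i, (σ * ξ i - (A (x i).1 (x i).2 - A₀ (x i).1 (x i).2)) ^ 2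
      = ∑ i, (σ * ξ i) ^ 2 + ∑ i, (A (x i).1 (x i).2 - A₀ (x i).1 (x i).2) ^ 2
        - 2 * σ * ∑ i, ξ i * (A (x i).1 (x i).2 - A₀ (x i).1 (x i).2) := by
    rw [Finset.mul_sum, ← Finset.sum_add_distrib, ← Finset.sum_sub_distrib]
    exact Finset.sum_congr rfl fun i _ => by ring
  rw [hexp] at hmin
  have hnoise := (le_abs_self _).trans (abs_sum_mul_sub_le x ξ A A₀)
  have h1 := mul_le_mul_of_nonneg_left hnoise (by positivity : 0 ≤ 2 * σ)
  have h2 := mul_le_mul_of_nonneg_left hmin hn'.le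
  have hscale : ∀ X Y : ℝ, (n : ℝ) * (1 / n * X + Y) = X + n * Y := fun X Y => by field_simp
  rw [hscale, hscale] at h2
  linarith

/-- The population quadratic form dominates the Frobenius norm. -/
lemma NearUniform.frobeniusNorm_sq_le {p : Fin m₁ → Fin m₂ → ℝ} {ν : ℝ} (hp : NearUniform p ν)
    (hν : 0 < ν) (h₁ : 0 < m₁) (h₂ : 0 < m₂) (D : Matrix (Fin m₁) (Fin m₂) ℝ) :
    1 / ((m₁ : ℝ) * m₂) * frobeniusNorm D ^ 2
      ≤ ν * ∑ a : Fin m₁ × Fin m₂, p a.1 a.2 * D a.1 a.2 ^ 2 := by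
  have h1 : (0 : ℝ) < m₁ := by exact_mod_cast h₁
  have h2 : (0 : ℝ) < m₂ := by exact_mod_cast h₂
  rw [frobeniusNorm_sq, ← Fintype.sum_prod_type', Finset.mul_sum, Finset.mul_sum]
  refine Finset.sum_le_sum fun a _ => ?_
  rw [← mul_assoc]
  refine mul_le_mul_of_nonneg_right ?_ (sq_nonneg _)
  calc 1 / ((m₁ : ℝ) * m₂) = ν * (1 / (ν * m₁ * m₂)) := by field_simp
    _ ≤ _ := mul_le_mul_of_nonneg_left (hp a.1 a.2).1 hν.le

/-- The deterministic part of the oracle inequality, on the event where the noise is bounded and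
the empirical quadratic form satisfies its lower bound. -/
lemma IsTL1Estimator.quadratic_form_le {p : Fin m₁ → Fin m₂ → ℝ}
    {A₀ A : Matrix (Fin m₁) (Fin m₂) ℝ} {σ lam a ζ γ c b q S L τ : ℝ}
    {T : Fin n → Matrix (Fin m₁) (Fin m₂) ℝ} {ξ : Fin n → ℝ} {x : Fin n → Fin m₁ × Fin m₂}
    (hT : ∀ i, T i = Matrix.single (x i).1 (x i).2 1) (hσ : 0 < σ) (ha : 0 < a) (hζ : 0 ≤ ζ)
    (hc : 0 < c) (hb : 0 < b) (hS : 0 ≤ S) (h₁ : 0 < m₁) (h₂ : 0 < m₂) (hn : 0 < n)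
    (hA₀ : A₀ ∈ entryBall m₁ m₂ ζ)
    (hγ : nuclearNorm A₀ / Real.sqrt (m₁ * m₂) ≤ γ) (hq : ζ * Real.sqrt (m₁ * m₂) ≤ q * a)
    (hlam₁ : (2 * c * deviationConst b + 8 * deviationConst b) * lambdaOrder m₁ m₂ n L ζ σ a ≤ lam)
    (hlam₂ : lam ≤ S * lambdaOrder m₁ m₂ n L ζ σ a)
    (hnoise : ‖markedMatrix x ξ‖ ≤ c * normBound m₁ m₂ n L b)
    (hviol : x ∉ violationSet n p A₀ ζ (normBound m₁ m₂ n L b) (n * τ))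
    (h : IsTL1Estimator T (observation A₀ σ T ξ) lam a ζ A) :
    ∑ e : Fin m₁ × Fin m₂, p e.1 e.2 * (A e.1 e.2 - A₀ e.1 e.2) ^ 2
      ≤ (2 * c * deviationConst b + 8 * deviationConst b + S * (1 + q)) * max ζ σ * γ *
        mainRate m₁ m₂ n L + τ := by
  have h1 : (0 : ℝ) < m₁ := by exact_mod_cast h₁
  have h2 : (0 : ℝ) < m₂ := by exact_mod_cast h₂
  have hn' : (0 : ℝ) < n := by exact_mod_cast hn
  have hH := deviationConst_pos hb
  have hbasic := h.basic_inequality hT hσ.le hn hA₀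
  have hquad : ∑ i : Fin n,
        ((∑ a : Fin m₁ × Fin m₂, p a.1 a.2 * (A a.1 a.2 - A₀ a.1 a.2) ^ 2)
          - (A (x i).1 (x i).2 - A₀ (x i).1 (x i).2) ^ 2)
        - 8 * ζ * normBound m₁ m₂ n L b * (nuclearNorm A + nuclearNorm A₀) ≤ n * τ := by
    by_contra hcon
    exact hviol ⟨A, h.1, not_le.1 hcon⟩
  rw [Finset.sum_sub_distrib, Finset.sum_const, Finset.card_univ, Fintype.card_fin,
    nsmul_eq_mul] at hquad
  set Q := ∑ e : Fin m₁ × Fin m₂, p e.1 e.2 * (A e.1 e.2 - A₀ e.1 e.2) ^ 2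
  set H := deviationConst b with hHdef
  set R := Real.sqrt ((m₁ : ℝ) * m₂) with hR
  have hR0 : 0 < R := Real.sqrt_pos.2 (by positivity)
  set ρ := mainRate m₁ m₂ n L with hρ
  have hρ0 : 0 ≤ ρ := Real.sqrt_nonneg _
  have hB : normBound m₁ m₂ n L b = H * (n * (ρ / R)) := rfl
  have hΛ : lambdaOrder m₁ m₂ n L ζ σ a = max ζ σ / R * ((a + ζ * R) / (1 + a)) * ρ := rfl
  set M := max ζ σ with hM
  have hM0 : 0 < M := lt_of_lt_of_le hσ (le_max_right _ _)
  have hN := nuclearNorm_nonneg A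
  have hN₀ := nuclearNorm_nonneg A₀
  have hx0 : 0 ≤ ρ / R := by positivity
  have hΛ0 : 0 ≤ lambdaOrder m₁ m₂ n L ζ σ a := by rw [hΛ]; positivity
  have hlam0 : 0 ≤ lam := le_trans (by positivity) hlam₁
  -- The factor (a + ζR)/(1 + a) in the order of λ meets (a + 1)/a from the upper bound on TL1. The
  -- condition ζR ≤ qa bounds what is left by 1 + q.
  have hup : lam * TL1 a A₀ ≤ S * (1 + q) * (M * (ρ / R) * nuclearNorm A₀) := by
    calc lam * TL1 a A₀
        ≤ (S * lambdaOrder m₁ m₂ n L ζ σ a) * ((a + 1) / a * nuclearNorm A₀) :=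
          mul_le_mul hlam₂ (TL1_le ha A₀) (TL1_nonneg ha A₀) (by positivity)
      _ = S * ((a + ζ * R) / a) * (M * (ρ / R) * nuclearNorm A₀) := by
          rw [hΛ]; field_simp; ring
      _ ≤ S * (1 + q) * (M * (ρ / R) * nuclearNorm A₀) := by
          refine mul_le_mul_of_nonneg_right (mul_le_mul_of_nonneg_left ?_ hS) (by positivity)
          rw [div_le_iff₀ ha]; linarith
  -- The same factor cancels exactly against the lower constant of the TL1 sandwich. With `hcross`,
  -- the penalty at A therefore covers every cross term in its nuclear norm.
  have hlow : (2 * c * H + 8 * H) * (M * (ρ / R) * nuclearNorm A) ≤ lam * TL1 a A := by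
    calc (2 * c * H + 8 * H) * (M * (ρ / R) * nuclearNorm A)
        = ((2 * c * H + 8 * H) * lambdaOrder m₁ m₂ n L ζ σ a) *
            ((a + 1) / (a + ζ * R) * nuclearNorm A) := by
          rw [hΛ]
          have : 0 < a + ζ * R := by positivity
          field_simp
          ring
      _ ≤ lam * TL1 a A := mul_le_mul hlam₁ (le_TL1 ha hζ h.1) (by positivity) hlam0
  have hcross : 2 * σ * (c * (H * (ρ / R))) + 8 * ζ * (H * (ρ / R))
      ≤ (2 * c * H + 8 * H) * (M * (ρ / R)) := by
    have e1 : σ ≤ M := le_max_right _ _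
    have e2 : ζ ≤ M := le_max_left _ _
    calc 2 * σ * (c * (H * (ρ / R))) + 8 * ζ * (H * (ρ / R))
        ≤ 2 * M * (c * (H * (ρ / R))) + 8 * M * (H * (ρ / R)) := by gcongr
      _ = _ := by ring
  have hnoise' : 2 * σ * (‖markedMatrix x ξ‖ * (nuclearNorm A + nuclearNorm A₀))
      ≤ 2 * σ * (c * normBound m₁ m₂ n L b * (nuclearNorm A + nuclearNorm A₀)) := by gcongr
  have hQ : n * Q ≤ n * ((2 * σ * (c * (H * (ρ / R))) + 8 * ζ * (H * (ρ / R))) *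
      (nuclearNorm A + nuclearNorm A₀) + (lam * TL1 a A₀ - lam * TL1 a A) + τ) := by
    rw [hB] at hquad hnoise'
    linarith
  have hQ' := le_of_mul_le_mul_left hQ hn'
  have hcross' := mul_le_mul_of_nonneg_right hcross (add_nonneg hN hN₀)
  have hfin : Q ≤ (2 * c * H + 8 * H + S * (1 + q)) * M * (ρ * (nuclearNorm A₀ / R)) + τ := by
    have : (2 * c * H + 8 * H + S * (1 + q)) * M * (ρ * (nuclearNorm A₀ / R))
        = (2 * c * H + 8 * H) * (M * (ρ / R) * nuclearNorm A₀)
          + S * (1 + q) * (M * (ρ / R) * nuclearNorm A₀) := by ring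
    rw [this]
    linarith
  have hq0 : 0 ≤ q := by
    by_contra hq'
    have : q * a < 0 := mul_neg_of_neg_of_pos (not_le.1 hq') ha
    have : 0 ≤ ζ * R := by positivity
    linarith
  refine hfin.trans (add_le_add_left ?_ τ)
  rw [mul_assoc _ γ, mul_comm γ]
  gcongr

end Oracle

end TL1Completion

/-! ### Choice of constants and assembly of the events. -/

theorem theorem1 :
    ∃ κ : ℝ → ℝ, (∀ L, 0 < κ L) ∧
    -- `c₀` is the noise constant, `b` the constant implied in `n ≳ d log d`
    ∀ c₀ : ℝ, 0 < c₀ → ∀ b : ℝ, 0 < b →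
    -- `s` and `S` are the constants implied in the order of the regularisation parameter,
    -- `q` is the one implied in `1 / a = O(1 / (ζ √(m₁ m₂)))`
    ∃ s : ℝ, 0 < s ∧ ∃ C₂ : ℝ, 0 < C₂ ∧
    ∀ S : ℝ, s ≤ S → ∀ q : ℝ, 0 < q →
    ∃ C₁ : ℝ, 0 < C₁ ∧
    ∀ (m₁ m₂ n : ℕ) (L ν ζ σ γ a lam : ℝ),
      1 ≤ L → 1 ≤ ν → 0 < σ → 0 < γ → 0 < a →
    ∀ (Ω : Type*) [MeasurableSpace Ω] (μ : Measure Ω) [IsProbabilityMeasure μ]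
      (p : Fin m₁ → Fin m₂ → ℝ)
      (T : Fin n → Ω → Matrix (Fin m₁) (Fin m₂) ℝ) (ξ : Fin n → Ω → ℝ)
      (A₀ : Matrix (Fin m₁) (Fin m₂) ℝ),
      0 < m₁ → 0 < m₂ →
      TL1Completion.IsTraceRegression μ p T ξ →
      TL1Completion.MarginalBound p L →
      TL1Completion.NearUniform p ν →
      TL1Completion.SubExponentialNoise μ ξ c₀ →
      A₀ ∈ TL1Completion.entryBall m₁ m₂ ζ →
      TL1Completion.nuclearNorm A₀ / Real.sqrt (m₁ * m₂) ≤ γ →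
      b * (TL1Completion.dimSum m₁ m₂ * Real.log (TL1Completion.dimSum m₁ m₂)) ≤ n →
      ζ * Real.sqrt (m₁ * m₂) ≤ q * a →
      s * TL1Completion.lambdaOrder m₁ m₂ n L ζ σ a ≤ lam →
      lam ≤ S * TL1Completion.lambdaOrder m₁ m₂ n L ζ σ a →
      ∃ E : Set Ω, MeasurableSet E ∧
        1 - (κ L + 1) / TL1Completion.dimSum m₁ m₂ ≤ μ.real E ∧
        ∀ ω ∈ E, ∀ Ahat : Matrix (Fin m₁) (Fin m₂) ℝ,
          TL1Completion.IsTL1Estimator (fun i => T i ω)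
            (TL1Completion.observation A₀ σ (fun i => T i ω) (fun i => ξ i ω)) lam a ζ Ahat →
          1 / ((m₁ : ℝ) * m₂) * TL1Completion.frobeniusNorm (Ahat - A₀) ^ 2 ≤
            C₁ * ν * max ζ σ * γ * TL1Completion.mainRate m₁ m₂ n L +
            C₂ * ν * ζ ^ 2 * Real.sqrt (L * Real.log (TL1Completion.dimSum m₁ m₂) / n) := by
  open TL1Completion in
  open scoped Matrix.Norms.L2Operator in
  -- The value κ = 1 works because exactly two bad events of probability at most 1/d each are
  -- excluded, besides a null set.
  refine ⟨fun _ => 1, fun _ => one_pos, fun c₀ hc₀ b hb => ?_⟩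
  have hH := deviationConst_pos hb
  -- The two summands of s match the coefficients of the nuclear norms from the noise term and from
  -- the quadratic form bound. The constant C₂ is the slack in the violation event.
  refine ⟨2 * c₀ * deviationConst b + 8 * deviationConst b, by positivity,
    16 * deviationConst b, by positivity, fun S hS q hq => ?_⟩
  have hS0 : 0 < S := lt_of_lt_of_le (by positivity) hS
  refine ⟨2 * c₀ * deviationConst b + 8 * deviationConst b + S * (1 + q), by positivity, ?_⟩
  intro m₁ m₂ n L ν ζ σ γ a lam hL hν hσ hγ ha Ω _ μ _ p T ξ A₀ h₁ h₂ hreg hmarg hunif hsub hA₀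
    hnuc hn hqa hlam₁ hlam₂
  have hd := two_le_dimSum h₁ h₂
  have hn0 : 0 < n := by
    have : 0 < b * (dimSum m₁ m₂ * Real.log (dimSum m₁ m₂)) := by
      have := Real.log_pos (by linarith : 1 < dimSum m₁ m₂)
      have : 0 < dimSum m₁ m₂ := by linarith
      positivity
    exact_mod_cast this.trans_le hn
  have hζ : 0 ≤ ζ := (abs_nonneg _).trans (hA₀ ⟨0, h₁⟩ ⟨0, h₂⟩)
  let a₀ : Fin m₁ × Fin m₂ := (⟨0, h₁⟩, ⟨0, h₂⟩)
  have hs := hreg.isMarkedSample hc₀ hsub a₀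
  set τ := 16 * deviationConst b * ζ ^ 2 * Real.sqrt (L * Real.log (dimSum m₁ m₂) / n) with hτ
  let B₁ : Set Ω := {ω | ¬ ∀ i, T i ω
    = Matrix.single (position a₀ (T i ω)).1 (position a₀ (T i ω)).2 1}
  let B₂ : Set Ω := {ω | c₀ * normBound m₁ m₂ n L b
    < ‖markedMatrix (fun i => position a₀ (T i ω)) fun i => ξ i ω‖}
  let B₃ : Set Ω := {ω | (fun i => position a₀ (T i ω))
    ∈ violationSet n p A₀ ζ (normBound m₁ m₂ n L b) (n * τ)}
  have hB₁ : μ.real B₁ = 0 := by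
    rw [measureReal_def, show μ B₁ = 0 from hreg.ae_eq_single a₀, ENNReal.toReal_zero]
  have hB₂ : μ.real B₂ ≤ 1 / dimSum m₁ m₂ :=
    measureReal_lt_norm_markedMatrix_le hc₀ hs (fun i => (hreg.noise_mean i).2)
      (fun i k => abs_integral_pow_le hc₀ (hreg.noise_measurable i) (hsub i).1 (hsub i).2 k)
      hmarg hL hb h₁ h₂ hn hn0
  have hB₃ : μ.real B₃ ≤ 1 / dimSum m₁ m₂ := by
    classical
    refine (hs.measureReal_mem _).trans_le ?_
    refine le_trans (le_of_eq ?_) (prodMean_violationSet_le (fun k l =>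
      hs.weight_nonneg ⟨0, hn0⟩ (k, l)) (hs.sum_weight ⟨0, hn0⟩) hmarg hL hb h₁ h₂ hn hn0 hζ hA₀)
    congr
  have hbad : μ.real (B₁ ∪ (B₂ ∪ B₃)) ≤ 2 / dimSum m₁ m₂ := by
    have e1 := measureReal_union_le (μ := μ) B₁ (B₂ ∪ B₃)
    have e2 := measureReal_union_le (μ := μ) B₂ B₃
    have e3 : 2 / dimSum m₁ m₂ = 1 / dimSum m₁ m₂ + 1 / dimSum m₁ m₂ := by ring
    linarith
  -- Passing to the measurable hull of the bad set keeps its measure and avoids proving that the bad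
  -- set itself is measurable.
  refine ⟨(toMeasurable μ (B₁ ∪ (B₂ ∪ B₃)))ᶜ, (measurableSet_toMeasurable _ _).compl, ?_, ?_⟩
  · rw [probReal_compl_eq_one_sub (measurableSet_toMeasurable _ _), measureReal_def,
      measure_toMeasurable, ← measureReal_def]
    norm_num
    linarith
  · intro ω hω A hA
    have hω' : ω ∉ B₁ ∪ (B₂ ∪ B₃) := fun h => hω (subset_toMeasurable _ _ h)
    simp only [Set.mem_union, not_or] at hω'
    obtain ⟨hω₁, hω₂, hω₃⟩ := hω'
    have hquad := hA.quadratic_form_le (p := p) (not_not.1 hω₁) hσ ha hζ hc₀ hb hS0.le h₁ h₂ hn0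
      hA₀ hnuc hqa hlam₁ hlam₂ (not_lt.1 hω₂) hω₃
    have hν0 : 0 < ν := by linarith
    refine (hunif.frobeniusNorm_sq_le hν0 h₁ h₂ (A - A₀)).trans ?_
    refine (mul_le_mul_of_nonneg_left hquad hν0.le).trans (le_of_eq ?_)
    rw [hτ]
    ring
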